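/- Notation. For a partition $\lambda=(\lambda_1\ge\lambda_2\ge\dots)$ write $l(\lambda)$ for its number of parts and $|\mathrm{Aut}\,\lambda|=\prod_{i\ge1}m_i!$, where $m_i$ is the multiplicity of $i$ in $\lambda$. For $\lambda,\mu\vdash d$ let $\chi^\lambda_\mu$ be the irreducible character of the symmetric group $S_d$ associated with $\lambda$, evaluated at a permutation of cycle type $\mu$, and let $$p_k(\lambda)=\sum_{i\ge1}\Bigl(\bigl(\lambda_i-i+\tfrac12\bigr)^k-\bigl(-i+\tfrac12\bigr)^k\Bigr).$$ For partitions $\alpha,\beta$ of $d>0$ and integers $g,s\ge0$, $r\ge1$ with $rs=2g-2+l(\alpha)+l(\beta)$, the (disconnected) double Hurwitz number with completed $(r+1)$-cycles is $$H^{g,(r)}_{\alpha,\beta}=\frac{1}{\prod_i\alpha_i\prod_j\beta_j}\sum_{\lambda\vdash d}\chi^\lambda_\alpha\left(\frac{p_{r+1}(\lambda)}{(r+1)!}\right)^{s}\chi^\lambda_\beta .$$ Theorem. Let $g\ge0$ and $d>0$ be integers, let $\beta$ be a partition of $d$ of odd length $n$, and let $s$ be the integer with $2s=2g-1+n$. Let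 $n_i$ be the multiplicity of $i$ in $\beta$, and put $c_1=n_1-1$ and $c_i=n_i$ for $i\ge2$. For $j\ge1$ put $\xi_{2j}=[x^{2j}]\log(\sinh x/x)$ and $S_{2j}=\sum_{k\ge1}k^{2j}c_k$, and for a partition $\lambda$ put $\xi_{2\lambda}=\prod_i\xi_{2\lambda_i}$ and $S_{2\lambda}=\prod_iS_{2\lambda_i}$. Then \begin{align*} H^{g,(2)}_{(d),\beta}&=\frac{s!\,d^{s-1}}{2^s}\sum_{h=0}^g\frac{(2s-2h)!}{h!\,(s-h)!\,12^h}\,d^{2h}\,[z^{2(g-h)}]\prod_{i\ge1}\left(\frac{\sinh(iz/2)}{iz/2}\right)^{c_i}\\ &=\frac{s!\,d^{s-1}}{2^{s+2g}}\sum_{h=0}^g\frac{(2s-2h)!}{h!\,(s-h)!\,3^h}\,d^{2h}\sum_{\lambda\vdash g-h}\frac{\xi_{2\lambda}S_{2\lambda}}{|\mathrm{Aut}\,\lambda|}. \end{align*} -/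

import Mathlib

open Equiv PowerSeries

noncomputable section

namespace Hurwitz

/-! ### Partitions -/

/-- The parts `λ₁ ≥ λ₂ ≥ … ≥ λ_m` of a partition, as a weakly decreasing list. -/
def sortedParts {d : ℕ} (lam : d.Partition) : List ℕ :=
  lam.parts.sort (· ≥ ·)

/-- The length `l(λ)` of a partition. -/
def len {d : ℕ} (lam : d.Partition) : ℕ := lam.parts.card

/-- `|Aut λ| = m₁! m₂! ⋯`, where `m_i` is the multiplicity of `i` in `λ`. -/
def autCard {d : ℕ} (lam : d.Partition) : ℕ :=
  ∏ i ∈ lam.parts.toFinset, (lam.parts.count i).factorial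

/-! ### Irreducible characters of the symmetric group -/

theorem sortedParts_sortedGE {d : ℕ} (lam : d.Partition) : (sortedParts lam).SortedGE :=
  (Multiset.pairwise_sort lam.parts (· ≥ ·)).sortedGE

/-- The Young diagram of a partition: row `i` has `λ_{i+1}` cells. -/
def youngDiagram {d : ℕ} (lam : d.Partition) : YoungDiagram :=
  YoungDiagram.ofRowLens (sortedParts lam) (sortedParts_sortedGE lam)

theorem card_cellsOfRowLens (w : List ℕ) : (YoungDiagram.cellsOfRowLens w).card = w.sum := by
  induction w with
  | nil => simp [YoungDiagram.cellsOfRowLens]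
  | cons a w ih =>
    rw [YoungDiagram.cellsOfRowLens, Finset.card_union_of_disjoint]
    · simp [ih]
    · rw [Finset.disjoint_left]
      rintro ⟨i, j⟩ h1 h2
      simp at h1 h2
      omega

theorem card_cells_youngDiagram {d : ℕ} (lam : d.Partition) :
    (youngDiagram lam).cells.card = d := by
  change (YoungDiagram.cellsOfRowLens (sortedParts lam)).card = d
  rw [card_cellsOfRowLens, ← Multiset.sum_coe, sortedParts, Multiset.sort_eq, lam.parts_sum]

/-- A (bijective) Young tableau of shape `λ ⊢ d`, placing each of the `d` letters in a cell. -/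
abbrev Tableau {d : ℕ} (lam : d.Partition) : Type :=
  Fin d ≃ (youngDiagram lam).cells

theorem nonempty_tableau {d : ℕ} (lam : d.Partition) : Nonempty (Tableau lam) :=
  ⟨Fintype.equivOfCardEq (by simp [card_cells_youngDiagram])⟩

/-- The row of the tableau containing a letter. -/
def Tableau.row {d : ℕ} {lam : d.Partition} (t : Tableau lam) (x : Fin d) : ℕ := (t x).1.1

/-- The column of the tableau containing a letter. -/
def Tableau.col {d : ℕ} {lam : d.Partition} (t : Tableau lam) (x : Fin d) : ℕ := (t x).1.2

/-- The group algebra `ℚ S_d`. -/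
abbrev GroupAlg (d : ℕ) : Type := MonoidAlgebra ℚ (Perm (Fin d))

/-- The sum of all permutations preserving the rows of the tableau. -/
def rowSymmetrizer {d : ℕ} {lam : d.Partition} (t : Tableau lam) : GroupAlg d :=
  ∑ σ : Perm (Fin d) with ∀ x, Tableau.row t (σ x) = Tableau.row t x, MonoidAlgebra.single σ 1

/-- The signed sum of all permutations preserving the columns of the tableau. -/
def colAntisymmetrizer {d : ℕ} {lam : d.Partition} (t : Tableau lam) : GroupAlg d :=
  ∑ σ : Perm (Fin d) with ∀ x, Tableau.col t (σ x) = Tableau.col t x,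
    MonoidAlgebra.single σ ((Perm.sign σ : ℤ) : ℚ)

/-- The Young symmetrizer of a tableau. -/
def youngSymmetrizer {d : ℕ} {lam : d.Partition} (t : Tableau lam) : GroupAlg d :=
  rowSymmetrizer t * colAntisymmetrizer t

/-- The Specht module: the left ideal of `ℚ S_d` generated by the Young symmetrizer. It is the
irreducible `S_d`-module associated with `λ`; `λ = (d)` gives the trivial module. -/
abbrev SpechtModule {d : ℕ} {lam : d.Partition} (t : Tableau lam) :
    Submodule (GroupAlg d) (GroupAlg d) :=
  Submodule.span (GroupAlg d) {youngSymmetrizer t}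

/-- The action of `S_d` on the Specht module by left multiplication. -/
def spechtRep {d : ℕ} {lam : d.Partition} (t : Tableau lam) :
    Representation ℚ (Perm (Fin d)) (SpechtModule t) :=
  ((Algebra.lsmul ℚ ℚ (SpechtModule t) : GroupAlg d →ₐ[ℚ] Module.End ℚ (SpechtModule t)) :
    GroupAlg d →* Module.End ℚ (SpechtModule t)).comp (MonoidAlgebra.of ℚ (Perm (Fin d)))

/-- The irreducible character of `S_d` associated with `λ ⊢ d`. (Different tableaux of shape `λ`
give isomorphic Specht modules, so the chosen tableau is immaterial.) -/
def irrChar {d : ℕ} (lam : d.Partition) (σ : Perm (Fin d)) : ℚ :=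
  (spechtRep (nonempty_tableau lam).some).character σ

theorem exists_perm_of_partition {d : ℕ} (mu : d.Partition) :
    ∃ σ : Perm (Fin d), σ.partition.parts = mu.parts := by
  have hsum : (mu.parts.filter (2 ≤ ·)).sum + (mu.parts.filter (¬ 2 ≤ ·)).sum = d := by
    rw [← Multiset.sum_add, Multiset.filter_add_not, mu.parts_sum]
  have hone : mu.parts.filter (¬ 2 ≤ ·) =
      Multiset.replicate (mu.parts.filter (¬ 2 ≤ ·)).card 1 := by
    rw [Multiset.eq_replicate]
    refine ⟨rfl, fun b hb => ?_⟩
    rw [Multiset.mem_filter] at hb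
    have := mu.parts_pos hb.1
    omega
  obtain ⟨σ, hσ⟩ := (Perm.exists_with_cycleType_iff (Fin d)
    (m := mu.parts.filter (2 ≤ ·))).2 ⟨by rw [Fintype.card_fin]; omega, fun a ha =>
      (Multiset.mem_filter.1 ha).2⟩
  refine ⟨σ, ?_⟩
  rw [Perm.parts_partition, ← Perm.sum_cycleType, hσ, Fintype.card_fin]
  conv_rhs => rw [← Multiset.filter_add_not (2 ≤ ·) mu.parts, hone]
  have h1 : (mu.parts.filter (¬ 2 ≤ ·)).sum = (mu.parts.filter (¬ 2 ≤ ·)).card := by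
    conv_lhs => rw [hone]
    simp
  congr 2
  omega

/-- A permutation of cycle type `μ` (fixed points counted as parts equal to `1`). -/
def permOfPartition {d : ℕ} (mu : d.Partition) : Perm (Fin d) :=
  (exists_perm_of_partition mu).choose

/-- `χ^λ_μ`: the irreducible character associated with `λ`, evaluated on the conjugacy class of
permutations of cycle type `μ`. -/
def chi {d : ℕ} (lam mu : d.Partition) : ℚ :=
  irrChar lam (permOfPartition mu)

/-! ### Double Hurwitz numbers with completed cycles -/

/-- The shifted symmetric power sum
`p_k(λ) = ∑_{i ≥ 1} ((λ_i - i + 1/2)^k - (-i + 1/2)^k)`; the terms with `i > l(λ)` vanish.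
With rows indexed from `0`, `-i + 1/2` becomes `-i - 1/2`. -/
def shiftedPowerSum (k : ℕ) {d : ℕ} (lam : d.Partition) : ℚ :=
  ∑ i : Fin (sortedParts lam).length,
    ((((sortedParts lam).get i : ℚ) - (i : ℚ) - 1 / 2) ^ k - (-(i : ℚ) - 1 / 2) ^ k)

/-- The number `s` of completed `(r+1)`-cycles, determined by `r s = 2g - 2 + l(α) + l(β)`
(for `d > 0` the subtraction does not truncate; the division is exact whenever such an `s`
exists and `r > 0`). -/
def numCycles (g r : ℕ) {d : ℕ} (α β : d.Partition) : ℕ :=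
  (2 * g + len α + len β - 2) / r

/-- The disconnected double Hurwitz number `H^{g,(r)}_{α,β}` with completed `(r+1)`-cycles. -/
def doubleHurwitz (g r : ℕ) {d : ℕ} (α β : d.Partition) : ℚ :=
  1 / ((α.parts.prod : ℚ) * (β.parts.prod : ℚ)) *
    ∑ lam : d.Partition, chi lam α *
      (shiftedPowerSum (r + 1) lam / ((r + 1).factorial : ℚ)) ^ numCycles g r α β * chi lam β

/-! ### The quantities in the explicit formulae -/

/-- `c_1 = n_1 - 1` and `c_i = n_i` for `i ≥ 2`, where `n_i` is the multiplicity of `i` in `β`. -/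
def cExp {d : ℕ} (β : d.Partition) (i : ℕ) : ℤ :=
  (β.parts.count i : ℤ) - if i = 1 then 1 else 0

/-- The formal power series `sinh z = (e^z - e^{-z}) / 2`. -/
def sinhSeries : ℚ⟦X⟧ :=
  C (1 / 2 : ℚ) * (PowerSeries.exp ℚ - rescale (-1 : ℚ) (PowerSeries.exp ℚ))

/-- The formal power series `sinh z / z` (`sinh z` has no constant term). -/
def sinhc : ℚ⟦X⟧ :=
  PowerSeries.mk fun n => coeff (n + 1) sinhSeries

/-- `∏_{i ≥ 1} (sinh(iz/2) / (iz/2))^{c_i}`. As `c_1` may be `-1`, it is formed in the field of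
Laurent series; the factors with `i > d` are `1` when `d ≥ 1`. -/
def sinhProduct {d : ℕ} (β : d.Partition) : LaurentSeries ℚ :=
  ∏ i ∈ Finset.Icc 1 d,
    ((rescale ((i : ℚ) / 2) sinhc : ℚ⟦X⟧) : LaurentSeries ℚ) ^ cExp β i

/-- `ξ_j = [x^j] log (sinh x / x)`. -/
def xi (j : ℕ) : ℚ := coeff j (PowerSeries.logOf sinhc)

/-- `S_j = ∑_{k ≥ 1} k^j c_k` (the terms with `k > d` vanish when `d ≥ 1`). -/
def powS {d : ℕ} (β : d.Partition) (j : ℕ) : ℚ :=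
  ∑ k ∈ Finset.Icc 1 d, (k : ℚ) ^ j * (cExp β k : ℚ)

/-- `ξ_{2λ} = ξ_{2λ₁} ξ_{2λ₂} ⋯`. -/
def xiTwo {k : ℕ} (lam : k.Partition) : ℚ :=
  (lam.parts.map fun a => xi (2 * a)).prod

/-- `S_{2λ} = S_{2λ₁} S_{2λ₂} ⋯`. -/
def powSTwo {d : ℕ} (β : d.Partition) {k : ℕ} (lam : k.Partition) : ℚ :=
  (lam.parts.map fun a => powS β (2 * a)).prod

end Hurwitz

end

/-!
Let `a` and `b` be the row symmetrizer and the column antisymmetrizer of a tableau. The trace of a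
permutation `σ` on the left ideal generated by the Young symmetrizer `c = a b` can be read off the
coefficients of the conjugates of `c`, since `c` is quasi-idempotent. For hooks, summing over all
fillings telescopes: with `q` marking the number of rows below the first, the generating
polynomial of the values at cycle type `β` of the hook characters is `∏ (1 - (-q) ^ β_i) / (1 + q)`.
At `q = -1` this says that the sum of all long cycles is a combination of hook symmetrizers, and
these annihilate the Specht modules of all other shapes. Hence only the hooks contribute to
`H_{(d),β}`, and for the hook with `k` rows below the first the completed 3-cycle
acts by `d / 2 * ((k - (d - 1) / 2) ^ 2 + d ^ 2 / 12)`.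

The generating polynomial at `q = -exp z`, multiplied by `exp (-(d - 1) z / 2)`, is
`(-z) ^ (n - 1) * ∏ β_i` times the product of `(sinh (iz/2) / (iz/2)) ^ c_i`. Comparing
coefficients yields the moments of the hook characters about `(d - 1) / 2`, and the binomial
theorem gives the first formula. Expanding the product as the exponential of its logarithm gives
the second.
-/

noncomputable section

namespace Hurwitz

section GroupAlgebra

open MonoidAlgebra

variable {G R : Type*} [Group G]

theorem mul_mul_eq_zero_of_single [CommSemiring R] {u v : MonoidAlgebra R G}
    (h : ∀ g r, u * single g r * v = 0) (y : MonoidAlgebra R G) : u * y * v = 0 := by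
  induction y using MonoidAlgebra.induction_linear with
  | zero => rw [mul_zero, zero_mul]
  | add x y hx hy => rw [mul_add, add_mul, hx, hy, add_zero]
  | single g r => exact h g r

theorem map_mul_mul_inv {M : Type*} [CommMonoid M] (ε : G →* M) (g τ : G) :
    ε (g * τ * g⁻¹) = ε τ := by
  rw [map_mul, map_mul, mul_right_comm, ← map_mul, mul_inv_cancel, map_one, one_mul]

variable [Fintype G]

theorem trace_lsmul_span_singleton [Field R] {c : MonoidAlgebra R G} {n : R} (hn : n ≠ 0)
    (hc : c * c = n • c) (σ : G) :
    LinearMap.trace R (Submodule.span (MonoidAlgebra R G) {c}) (Algebra.lsmul R R _ (of R G σ)) =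
      (∑ τ, single τ 1 * c * single τ⁻¹ 1).coeff σ⁻¹ / n := by
  classical
  set T : MonoidAlgebra R G →ₗ[R] MonoidAlgebra R G :=
    LinearMap.mulLeft R (single σ 1) ∘ₗ LinearMap.mulRight R (n⁻¹ • c) with hT
  have hmem (x) : T x ∈ (Submodule.span (MonoidAlgebra R G) {c}).restrictScalars R := by
    refine Submodule.mem_span_singleton.2 ⟨n⁻¹ • (single σ 1 * x), ?_⟩
    simp [hT, mul_assoc]
  have hrestrict : T.restrict (p := (Submodule.span (MonoidAlgebra R G) {c}).restrictScalars R)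
      (fun x _ => hmem x) =
        Algebra.lsmul R R (Submodule.span (MonoidAlgebra R G) {c}) (of R G σ) := by
    ext1 ⟨x, hx⟩
    obtain ⟨y, rfl⟩ := Submodule.mem_span_singleton.1 hx
    refine Subtype.ext (congrArg (single σ 1 * ·) (?_ : y * c * (n⁻¹ • c) = y * c))
    rw [mul_assoc, mul_smul_comm, hc, smul_smul, inv_mul_cancel₀ hn, one_smul]
  rw [← hrestrict]
  refine (LinearMap.trace_restrict_eq_of_forall_mem _ T hmem).trans ?_
  rw [LinearMap.trace_eq_matrix_trace R (MonoidAlgebra.basis G R), Matrix.trace, coeff_sum,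
    Finsupp.finsetSum_apply, Finset.sum_div]
  refine Finset.sum_congr rfl fun τ _ => ?_
  rw [Matrix.diag_apply, LinearMap.toMatrix_apply, basis_apply]
  change (single σ 1 * (single τ 1 * (n⁻¹ • c))).coeff τ = _
  simp [mul_assoc, div_eq_inv_mul]

/-- The sum of `ε g • g` over a subgroup: the quasi-idempotent of the group algebra that projects
onto the vectors on which the subgroup acts through the linear character `ε`. -/
def twistedSum [CommSemiring R] (ε : G →* R) (H : Subgroup G) : MonoidAlgebra R G :=
  open Classical in ∑ g with g ∈ H, single g (ε g)

variable [CommSemiring R] {ε ε' : G →* R} {H K : Subgroup G} {g : G}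

theorem single_mul_twistedSum (hg : g ∈ H) :
    single g (ε g) * twistedSum ε H = twistedSum ε H := by
  classical
  rw [twistedSum, Finset.mul_sum]
  refine Finset.sum_equiv (Equiv.mulLeft g) (fun τ => ?_) fun τ _ => ?_
  · simp [H.mul_mem_cancel_left hg]
  · simp [single_mul_single]

theorem twistedSum_mul_single (hg : g ∈ H) :
    twistedSum ε H * single g (ε g) = twistedSum ε H := by
  classical
  rw [twistedSum, Finset.sum_mul]
  refine Finset.sum_equiv (Equiv.mulRight g) (fun τ => ?_) fun τ _ => ?_
  · simp [H.mul_mem_cancel_right hg]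
  · simp [single_mul_single]

theorem conj_twistedSum (g : G) (h : ∀ τ, τ ∈ H ↔ g * τ * g⁻¹ ∈ K) :
    single g 1 * twistedSum ε H * single g⁻¹ 1 = twistedSum ε K := by
  classical
  rw [twistedSum, twistedSum, Finset.mul_sum, Finset.sum_mul]
  refine Finset.sum_equiv (MulAut.conj g).toEquiv (fun τ => ?_) fun τ _ => ?_
  · simp [h]
  · simp [single_mul_single, map_mul_mul_inv]

open Classical in
theorem twistedSum_mul_twistedSum : twistedSum ε H * twistedSum ε' K =
    ∑ x ∈ ({g | g ∈ H} : Finset G) ×ˢ ({g | g ∈ K} : Finset G),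
      single (x.1 * x.2) (ε x.1 * ε' x.2) := by
  simp only [twistedSum, Finset.sum_mul_sum, ← Finset.sum_product', single_mul_single]

theorem twistedSum_mul_single_mul_twistedSum_eq_zero {R : Type*} [CommRing R] [NoZeroDivisors R]
    {ε ε' : G →* R} {τ : G} (r : R) (hH : g * τ * g⁻¹ ∈ H) (hK : τ ∈ K) (hε : ε τ ≠ ε' τ) :
    twistedSum ε H * single g r * twistedSum ε' K = 0 := by
  set w := twistedSum ε H * single (g * τ) r * twistedSum ε' K with hw
  have hleft : ε τ • w = twistedSum ε H * single g r * twistedSum ε' K := by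
    nth_rw 1 [← twistedSum_mul_single (ε := ε) hH]
    rw [map_mul_mul_inv, hw, mul_assoc _ (single _ _) (single g r), single_mul_single,
      inv_mul_cancel_right, ← smul_mul_assoc, ← mul_smul_comm, smul_single, smul_eq_mul]
  have hright : ε' τ • w = twistedSum ε H * single g r * twistedSum ε' K := by
    nth_rw 1 [← single_mul_twistedSum (ε := ε') hK]
    rw [hw, ← mul_assoc, mul_assoc _ (single g r), single_mul_single,
      ← smul_mul_assoc, ← mul_smul_comm, smul_single, smul_eq_mul, mul_comm r]
  have hzero : (ε τ - ε' τ) • w = 0 := by rw [sub_smul, hleft, hright, sub_self]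
  rw [← hleft, (smul_eq_zero.1 hzero).resolve_left (sub_ne_zero.2 hε), smul_zero]

end GroupAlgebra

section PermsOn

open MonoidAlgebra

variable {α : Type*}

/-- The permutations moving only elements of `s`. -/
def permsOn (s : Finset α) : Subgroup (Perm α) :=
  fixingSubgroup (Perm α) {x | x ∉ s}

variable {s t : Finset α} {σ τ : Perm α} {o x y : α}

theorem mem_permsOn : σ ∈ permsOn s ↔ ∀ x ∉ s, σ x = x :=
  mem_fixingSubgroup_iff (Perm α)

theorem permsOn_mono (h : s ⊆ t) : permsOn s ≤ permsOn t :=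
  fun _ hσ => mem_permsOn.2 fun x hx => mem_permsOn.1 hσ x fun hxs => hx (h hxs)

theorem apply_mem_of_mem_permsOn (hσ : σ ∈ permsOn s) : σ x ∈ s ↔ x ∈ s := by
  constructor <;> intro hx <;> by_contra h
  · exact h (mem_permsOn.1 hσ x h ▸ hx)
  · have := σ.injective (mem_permsOn.1 hσ (σ x) h)
    exact h (this.symm ▸ hx)

theorem commute_of_mem_permsOn (h : Disjoint s t) (hσ : σ ∈ permsOn s) (hτ : τ ∈ permsOn t) :
    Commute σ τ := by
  refine Perm.Disjoint.commute fun x => ?_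
  by_cases hx : x ∈ s
  · exact Or.inr (mem_permsOn.1 hτ x (Finset.disjoint_left.1 h hx))
  · exact Or.inl (mem_permsOn.1 hσ x hx)

variable [DecidableEq α]

theorem swap_mem_permsOn (hx : x ∈ s) (hy : y ∈ s) : swap x y ∈ permsOn s :=
  mem_permsOn.2 fun _ hz => swap_apply_of_ne_of_ne (fun h => hz (h ▸ hx)) fun h => hz (h ▸ hy)

theorem mem_permsOn_erase : σ ∈ permsOn (s.erase o) ↔ σ ∈ permsOn s ∧ σ o = o := by
  refine ⟨fun h => ⟨permsOn_mono (s.erase_subset o) h, mem_permsOn.1 h o (by simp)⟩, fun h => ?_⟩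
  refine mem_permsOn.2 fun x hx => ?_
  rcases eq_or_ne x o with rfl | hxo
  · exact h.2
  · exact mem_permsOn.1 h.1 x fun hxs => hx (Finset.mem_erase.2 ⟨hxo, hxs⟩)

open scoped Pointwise in
theorem conj_mem_permsOn_smul : τ * σ * τ⁻¹ ∈ permsOn (τ • s) ↔ σ ∈ permsOn s := by
  simp only [mem_permsOn, Perm.mul_apply]
  refine ⟨fun h x hx => ?_, fun h x hx => ?_⟩
  · simpa using h (τ x) (by simpa [← Perm.smul_def] using hx)
  · rw [h (τ⁻¹ x) fun hxs => hx (by simpa using Finset.smul_mem_smul_finset (a := τ) hxs)]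
    exact τ.apply_symm_apply x

variable [Fintype α]

theorem card_permsOn (s : Finset α) [DecidablePred (· ∈ permsOn s)] :
    Finset.card {σ | σ ∈ permsOn s} = s.card.factorial := by
  rw [← card_perms_of_finset]
  congr 1
  ext σ
  simp only [Finset.mem_filter_univ, mem_permsOn, mem_perms_of_finset_iff]
  exact forall_congr' fun x => not_imp_comm

theorem twistedSum_permsOn_insert_eq_sum_mul {R : Type*} [CommSemiring R] (ε : Perm α →* R)
    (ho : o ∉ s) :
    twistedSum ε (permsOn (insert o s)) =
      (∑ x ∈ insert o s, single (swap o x) (ε (swap o x))) * twistedSum ε (permsOn s) := by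
  classical
  have hs : s = (insert o s).erase o := (Finset.erase_insert ho).symm
  rw [twistedSum, twistedSum, Finset.sum_mul_sum, ← Finset.sum_product']
  refine Finset.sum_bij' (fun σ _ => (σ o, swap o (σ o) * σ)) (fun p _ => swap o p.1 * p.2)
    (fun σ hσ => ?_) (fun p hp => ?_) (fun σ _ => ?_) (fun p hp => ?_) fun σ _ => ?_
  all_goals simp only [Finset.mem_product, Finset.mem_filter_univ] at *
  · have hσo : σ o ∈ insert o s :=
      (apply_mem_of_mem_permsOn hσ).2 (Finset.mem_insert_self o s)
    refine ⟨hσo, ?_⟩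
    rw [hs, mem_permsOn_erase]
    exact ⟨mul_mem (swap_mem_permsOn (Finset.mem_insert_self o s) hσo) hσ, by simp⟩
  · exact mul_mem (swap_mem_permsOn (Finset.mem_insert_self o s) hp.1)
      (permsOn_mono (Finset.subset_insert o s) hp.2)
  · simp
  · simp [mem_permsOn.1 hp.2 o ho]
  · rw [single_mul_single, ← map_mul, swap_mul_self_mul]

theorem twistedSum_permsOn_insert_eq_mul_sum {R : Type*} [CommSemiring R] (ε : Perm α →* R)
    (ho : o ∉ s) :
    twistedSum ε (permsOn (insert o s)) =
      twistedSum ε (permsOn s) * ∑ x ∈ insert o s, single (swap o x) (ε (swap o x)) := by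
  classical
  have hs : s = (insert o s).erase o := (Finset.erase_insert ho).symm
  rw [twistedSum, twistedSum, Finset.sum_mul_sum, ← Finset.sum_product']
  refine Finset.sum_bij' (fun σ _ => (σ * swap o (σ⁻¹ o), σ⁻¹ o)) (fun p _ => p.1 * swap o p.2)
    (fun σ hσ => ?_) (fun p hp => ?_) (fun σ _ => ?_) (fun p hp => ?_) fun σ _ => ?_
  all_goals simp only [Finset.mem_product, Finset.mem_filter_univ] at *
  · have hσo : σ⁻¹ o ∈ insert o s :=
      (apply_mem_of_mem_permsOn (inv_mem hσ)).2 (Finset.mem_insert_self o s)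
    refine ⟨?_, hσo⟩
    rw [hs, mem_permsOn_erase]
    exact ⟨mul_mem hσ (swap_mem_permsOn (Finset.mem_insert_self o s) hσo), by simp⟩
  · exact mul_mem (permsOn_mono (Finset.subset_insert o s) hp.1)
      (swap_mem_permsOn (Finset.mem_insert_self o s) hp.2)
  · simp
  · have hpo : p.1.symm o = o := mem_permsOn.1 (inv_mem hp.1) o ho
    simp [hpo, mul_assoc]
  · rw [single_mul_single, ← map_mul, mul_swap_mul_self]

/-- The sign of a permutation as a rational number. -/
def signHom : Perm α →* ℚ :=
  ((Int.castRingHom ℚ : ℤ →* ℚ).comp (Units.coeHom ℤ)).comp Perm.sign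

theorem signHom_swap (hxy : x ≠ y) : signHom (swap x y) = -1 := by
  simp [signHom, Perm.sign_swap hxy]

theorem twistedSum_mul_single_mul_twistedSum_eq_zero_of_swap {R : Type*} [CommRing R]
    [NoZeroDivisors R] {ε ε' : Perm α →* R} {H K : Subgroup (Perm α)} (r : R)
    (hH : swap (σ x) (σ y) ∈ H) (hK : swap x y ∈ K) (hε : ε (swap x y) ≠ ε' (swap x y)) :
    twistedSum ε H * single σ r * twistedSum ε' K = 0 := by
  refine twistedSum_mul_single_mul_twistedSum_eq_zero r ?_ hK hε
  rwa [mul_swap_eq_swap_mul, mul_inv_cancel_right]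

theorem one_swap_ne_signHom_swap (hxy : x ≠ y) :
    (1 : Perm α →* ℚ) (swap x y) ≠ signHom (swap x y) := by
  rw [signHom_swap hxy, MonoidHom.one_apply]
  norm_num

end PermsOn

section HookSymmetrizer

open MonoidAlgebra

variable {α : Type*} [Fintype α] [DecidableEq α] {o : α} {z : Finset α}

/-- The Young symmetrizer of the filling of a hook with corner `o` and leg (the first column
without its corner) `z`; its first row is `zᶜ`. -/
def hookSymmetrizer (o : α) (z : Finset α) : MonoidAlgebra ℚ (Perm α) :=
  twistedSum 1 (permsOn zᶜ) * twistedSum signHom (permsOn (insert o z))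

open scoped Pointwise in
theorem conj_hookSymmetrizer (τ : Perm α) (o : α) (z : Finset α) :
    single τ 1 * hookSymmetrizer o z * single τ⁻¹ 1 = hookSymmetrizer (τ • o) (τ • z) := by
  have hone : (single τ⁻¹ 1 * single τ 1 : MonoidAlgebra ℚ (Perm α)) = 1 := by
    rw [single_mul_single, inv_mul_cancel, mul_one, MonoidAlgebra.one_def]
  have hconj (ε : Perm α →* ℚ) (s : Finset α) : single τ 1 * twistedSum ε (permsOn s) *
      single τ⁻¹ 1 = twistedSum ε (permsOn (τ • s)) :=
    conj_twistedSum τ fun _ => conj_mem_permsOn_smul.symm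
  have hcompl : τ • zᶜ = (τ • z)ᶜ := by
    ext x
    simp [← Finset.inv_smul_mem_iff]
  rw [hookSymmetrizer, hookSymmetrizer, ← hcompl, ← Finset.smul_finset_insert, ← hconj, ← hconj]
  simp only [mul_assoc]
  rw [← mul_assoc (single τ⁻¹ 1) (single τ 1), hone, one_mul]

/-- The key to `c * c = a (b a) b`, for `c = a b` with row symmetrizer `a` and column
antisymmetrizer `b`: a product `q p` from `b a` either can be reordered and absorbed, or moves both
`o` and `q⁻¹ o` into the row. -/
theorem rowSum_mul_single_mul_colSum (ho : o ∉ z) {p q : Perm α} (hp : p ∈ permsOn zᶜ)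
    (hq : q ∈ permsOn (insert o z)) :
    twistedSum 1 (permsOn zᶜ) * single (q * p) (signHom q) *
        twistedSum signHom (permsOn (insert o z)) =
      if q o = o ∨ p o = o then hookSymmetrizer o z else 0 := by
  split_ifs with hfix
  · have hcomm : Commute p q := by
      rcases hfix with hqo | hpo
      · refine commute_of_mem_permsOn disjoint_compl_left hp ?_
        exact Finset.erase_insert ho ▸ mem_permsOn_erase.2 ⟨hq, hqo⟩
      · refine commute_of_mem_permsOn ?_ (mem_permsOn_erase.2 ⟨hp, hpo⟩) hq
        rw [Finset.disjoint_insert_right]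
        exact ⟨Finset.notMem_erase o _, disjoint_compl_left.mono_left (Finset.erase_subset o _)⟩
    rw [← hcomm.eq, ← one_mul (signHom q), ← single_mul_single, ← mul_assoc, mul_assoc,
      single_mul_twistedSum hq, hookSymmetrizer]
    congr 1
    exact twistedSum_mul_single (ε := 1) hp
  · obtain ⟨hqo, hpo⟩ := not_or.1 hfix
    have hpz : p o ∈ zᶜ := (apply_mem_of_mem_permsOn hp).2 (Finset.mem_compl.2 ho)
    have hqpo : q (p o) = p o := mem_permsOn.1 hq _ fun h =>
      (Finset.mem_insert.1 h).elim hpo (Finset.mem_compl.1 hpz)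
    have hq' : q⁻¹ o ∈ insert o z :=
      (apply_mem_of_mem_permsOn (inv_mem hq)).2 (Finset.mem_insert_self o z)
    have hq'o : q⁻¹ o ≠ o := fun h => hqo (Perm.inv_eq_iff_eq.1 h).symm
    have hpq' : p (q⁻¹ o) = q⁻¹ o := mem_permsOn.1 hp _ fun h =>
      Finset.mem_compl.1 h ((Finset.mem_insert.1 hq').resolve_left hq'o)
    refine twistedSum_mul_single_mul_twistedSum_eq_zero_of_swap _ ?_
      (swap_mem_permsOn hq' (Finset.mem_insert_self o z)) (one_swap_ne_signHom_swap hq'o)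
    refine swap_mem_permsOn ?_ ?_
    · rw [Perm.mul_apply, hpq']
      simpa using ho
    · rwa [Perm.mul_apply, hqpo]

open Classical in
theorem card_fixed_pairs (ho : o ∉ z) :
    Finset.card {x ∈ ({q | q ∈ permsOn (insert o z)} : Finset (Perm α)) ×ˢ
        ({p | p ∈ permsOn zᶜ} : Finset (Perm α)) | x.1 o = o ∨ x.2 o = o} =
      Fintype.card α * (z.card.factorial * (zᶜ.erase o).card.factorial) := by
  set A : Finset (Perm α) := {q | q ∈ permsOn (insert o z)}
  set A' : Finset (Perm α) := {q | q ∈ permsOn z}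
  set B : Finset (Perm α) := {p | p ∈ permsOn zᶜ}
  set B' : Finset (Perm α) := {p | p ∈ permsOn (zᶜ.erase o)}
  have hA' {q : Perm α} : q ∈ A' ↔ q ∈ A ∧ q o = o := by
    simp only [A, A', Finset.mem_filter_univ, ← mem_permsOn_erase, Finset.erase_insert ho]
  have hB' {p : Perm α} : p ∈ B' ↔ p ∈ B ∧ p o = o := by
    simp only [B, B', Finset.mem_filter_univ, mem_permsOn_erase]
  have hunion : {x ∈ A ×ˢ B | x.1 o = o ∨ x.2 o = o} = A' ×ˢ B ∪ A ×ˢ B' := by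
    ext x
    simp only [Finset.mem_filter, Finset.mem_union, Finset.mem_product, hA', hB']
    tauto
  have hinter : A' ×ˢ B ∩ A ×ˢ B' = A' ×ˢ B' := by
    ext x
    simp only [Finset.mem_inter, Finset.mem_product, hA', hB']
    tauto
  have hcompl : zᶜ.card = (zᶜ.erase o).card + 1 :=
    (Finset.card_erase_add_one (Finset.mem_compl.2 ho)).symm
  have hincl := Finset.card_union_add_card_inter (A' ×ˢ B) (A ×ˢ B')
  simp only [hinter, Finset.card_product, A, A', B, B', card_permsOn, hcompl,
    Finset.card_insert_of_notMem ho, Nat.factorial_succ] at hincl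
  rw [hunion, ← Finset.card_add_card_compl z, hcompl]
  linarith

theorem hookSymmetrizer_mul_self (ho : o ∉ z) :
    hookSymmetrizer o z * hookSymmetrizer o z =
      ((Fintype.card α * (z.card.factorial * (zᶜ.erase o).card.factorial) : ℕ) : ℚ) •
        hookSymmetrizer o z := by
  classical
  rw [Nat.cast_smul_eq_nsmul, ← card_fixed_pairs ho, ← Finset.sum_const, Finset.sum_filter]
  calc hookSymmetrizer o z * hookSymmetrizer o z
      = twistedSum 1 (permsOn zᶜ) * (twistedSum signHom (permsOn (insert o z)) *
          twistedSum 1 (permsOn zᶜ)) * twistedSum signHom (permsOn (insert o z)) := by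
        simp only [hookSymmetrizer, mul_assoc]
    _ = _ := by
        rw [twistedSum_mul_twistedSum, Finset.mul_sum, Finset.sum_mul]
        refine Finset.sum_congr rfl fun x hx => ?_
        simp only [Finset.mem_product, Finset.mem_filter_univ] at hx
        rw [MonoidHom.one_apply, mul_one, rowSum_mul_single_mul_colSum ho hx.2 hx.1]

end HookSymmetrizer

section SumOverStableSets

open MonoidAlgebra

variable {α : Type*} [DecidableEq α]

theorem sum_Icc_pow_card {R : Type*} [CommSemiring R] {s t : Finset α} (h : s ⊆ t) (x : R) :
    ∑ z ∈ Finset.Icc s t, x ^ z.card = x ^ s.card * (1 + x) ^ (t.card - s.card) := by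
  have hdisj {u : Finset α} (hu : u ∈ (t \ s).powerset) : Disjoint s u :=
    Finset.disjoint_sdiff.mono_right (Finset.mem_powerset.1 hu)
  rw [Finset.Icc_eq_image_powerset h, Finset.sum_image fun u hu v hv huv => ?_,
    ← Finset.card_sdiff_of_subset h, add_comm 1 x, ← Finset.sum_pow_mul_eq_add_pow, Finset.mul_sum]
  · refine Finset.sum_congr rfl fun u hu => ?_
    rw [Finset.card_union_of_disjoint (hdisj hu), pow_add, one_pow, mul_one]
  · rw [← Finset.union_sdiff_cancel_left (hdisj hu), huv,
      Finset.union_sdiff_cancel_left (hdisj hv)]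

variable [Fintype α]

theorem exists_cycleFactorsFinset_eq {σ : Perm α} {S : Finset (Perm α)}
    (hS : S ⊆ σ.cycleFactorsFinset) :
    ∃ q : Perm α, q.Disjoint (σ * q⁻¹) ∧ q.cycleFactorsFinset = S := by
  have hdisj := σ.cycleFactorsFinset_pairwise_disjoint
  have hfactors {T : Finset (Perm α)} (hT : T ⊆ σ.cycleFactorsFinset) : ∃ q : Perm α,
      q.cycleFactorsFinset = T := by
    have hTd : (T : Set (Perm α)).Pairwise Perm.Disjoint :=
      hdisj.mono (Finset.coe_subset.2 hT)
    exact ⟨T.noncommProd id (hTd.mono' fun _ _ => Perm.Disjoint.commute),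
      Perm.cycleFactorsFinset_eq_finset.2 ⟨fun f hf =>
        (Perm.mem_cycleFactorsFinset_iff.1 (hT hf)).1, hTd, rfl⟩⟩
  obtain ⟨q, hq⟩ := hfactors hS
  obtain ⟨p, hp⟩ := hfactors (T := σ.cycleFactorsFinset \ S) Finset.sdiff_subset
  have hpq : p.Disjoint q := by
    rw [Perm.disjoint_iff_disjoint_support, Finset.disjoint_left]
    intro x hxp hxq
    obtain ⟨c, hc, hxc⟩ := Perm.mem_support_iff_mem_support_of_mem_cycleFactorsFinset.1 hxp
    obtain ⟨c', hc', hxc'⟩ := Perm.mem_support_iff_mem_support_of_mem_cycleFactorsFinset.1 hxq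
    rw [hp, Finset.mem_sdiff] at hc
    rw [hq] at hc'
    have hcc' : c.Disjoint c' := hdisj hc.1 (hS hc') fun h => hc.2 (h ▸ hc')
    exact Finset.disjoint_left.1 hcc'.disjoint_support hxc hxc'
  have hσ : p * q = σ := by
    apply Perm.cycleFactorsFinset_injective
    rw [hpq.cycleFactorsFinset_mul_eq_union, hp, hq, Finset.sdiff_union_of_subset hS]
  refine ⟨q, ?_, hq⟩
  rw [← hσ, mul_inv_cancel_right]
  exact hpq.symm

theorem sum_prod_cycleFactorsFinset {R : Type*} [CommSemiring R] (σ : Perm α) (f : Perm α → R)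
    [DecidablePred fun q : Perm α => q.Disjoint (σ * q⁻¹)] :
    ∑ q : Perm α with q.Disjoint (σ * q⁻¹), ∏ c ∈ q.cycleFactorsFinset, f c =
      ∏ c ∈ σ.cycleFactorsFinset, (1 + f c) := by
  rw [Finset.prod_one_add]
  refine Finset.sum_nbij Perm.cycleFactorsFinset (fun q hq => ?_)
    Perm.cycleFactorsFinset_injective.injOn (fun S hS => ?_) fun _ _ => rfl
  · have hq : q.Disjoint (σ * q⁻¹) := by simpa using hq
    rw [Finset.mem_powerset, ← inv_mul_cancel_right σ q, hq.symm.cycleFactorsFinset_mul_eq_union]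
    exact Finset.subset_union_right
  · obtain ⟨q, hq, rfl⟩ := exists_cycleFactorsFinset_eq (Finset.mem_powerset.1 hS)
    exact ⟨q, by simpa using hq, rfl⟩

theorem mem_permsOn_iff_support_subset {σ : Perm α} {s : Finset α} :
    σ ∈ permsOn s ↔ σ.support ⊆ s := by
  rw [mem_permsOn, Finset.subset_iff]
  exact forall_congr' fun x => by rw [Perm.mem_support, not_imp_comm]

theorem signHom_smul_pow_card_support (q : Perm α) :
    signHom q • (Polynomial.X : Polynomial ℚ) ^ q.support.card =
      ∏ c ∈ q.cycleFactorsFinset, -(-Polynomial.X) ^ c.support.card := by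
  induction q using Perm.cycle_induction_on with
  | base_one => simp
  | base_cycles q hq =>
    rw [Perm.cycleFactorsFinset_eq_singleton_self_iff.2 hq, Finset.prod_singleton, neg_pow]
    rcases (Nat.even_or_odd q.support.card) with h | h <;> simp [signHom, hq.sign, h.neg_one_pow]
  | induction_disjoint p q hpq _ ihp ihq =>
    rw [hpq.cycleFactorsFinset_mul_eq_union, Finset.prod_union hpq.disjoint_cycleFactorsFinset,
      ← ihp, ← ihq, map_mul, hpq.card_support_mul, pow_add, smul_mul_smul_comm]

theorem coeff_rowSum_mul_colSum (z : Finset α) (σ : Perm α) :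
    (twistedSum 1 (permsOn zᶜ) * twistedSum signHom (permsOn z)).coeff σ =
      ∑ q : Perm α with q.support ⊆ z ∧ z ⊆ (σ * q⁻¹).supportᶜ, signHom q := by
  classical
  have hrow (g : Perm α) : (twistedSum 1 (permsOn zᶜ) : MonoidAlgebra ℚ (Perm α)).coeff g =
      if g ∈ permsOn zᶜ then 1 else 0 := by
    simp [twistedSum, coeff_sum, Finsupp.finsetSum_apply, Finsupp.single_apply]
  rw [twistedSum.eq_1 signHom, Finset.mul_sum, coeff_sum, Finsupp.finsetSum_apply,
    Finset.sum_filter, Finset.sum_filter]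
  refine Finset.sum_congr rfl fun q _ => ?_
  rw [coeff_mul_single_apply, hrow, mem_permsOn_iff_support_subset, mem_permsOn_iff_support_subset,
    Finset.subset_compl_comm]
  simp only [ite_and, ite_mul, one_mul, zero_mul]

theorem sum_monomial_coeff_rowSum_mul_colSum (σ : Perm α) :
    ∑ z : Finset α, Polynomial.monomial z.card
        ((twistedSum 1 (permsOn zᶜ) * twistedSum signHom (permsOn z)).coeff σ) =
      (σ.partition.parts.map fun b => 1 - (-Polynomial.X) ^ b).prod := by
  classical
  calc ∑ z : Finset α, Polynomial.monomial z.card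
        ((twistedSum 1 (permsOn zᶜ) * twistedSum signHom (permsOn z)).coeff σ)
      = ∑ q : Perm α with q.Disjoint (σ * q⁻¹),
          ∑ z ∈ Finset.Icc q.support (σ * q⁻¹).supportᶜ, signHom q • Polynomial.X ^ z.card := by
        simp only [coeff_rowSum_mul_colSum, map_sum, ← Polynomial.smul_X_eq_monomial]
        refine Finset.sum_comm' fun z q => ?_
        simp only [Finset.mem_univ, true_and, Finset.mem_filter_univ, Finset.mem_Icc,
          Perm.disjoint_iff_disjoint_support, ← Finset.subset_compl_iff_disjoint_right]
        exact ⟨fun h => ⟨h, h.1.trans h.2⟩, And.left⟩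
    _ = ∑ q : Perm α with q.Disjoint (σ * q⁻¹),
          (∏ c ∈ q.cycleFactorsFinset, -(-Polynomial.X) ^ c.support.card) *
            (1 + Polynomial.X) ^ (Fintype.card α - σ.support.card) := by
        refine Finset.sum_congr rfl fun q hq => ?_
        have hq : q.Disjoint (σ * q⁻¹) := by simpa using hq
        have hcard : σ.support.card = (σ * q⁻¹).support.card + q.support.card := by
          rw [← hq.symm.card_support_mul, inv_mul_cancel_right]
        rw [← Finset.smul_sum, sum_Icc_pow_card, ← smul_mul_assoc, signHom_smul_pow_card_support,
          Finset.card_compl, hcard, Nat.sub_sub]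
        exact Finset.subset_compl_iff_disjoint_right.2 hq.disjoint_support
    _ = _ := by
        rw [← Finset.sum_mul, sum_prod_cycleFactorsFinset, Perm.parts_partition,
          Multiset.map_add, Multiset.prod_add, Perm.cycleType_def, Multiset.map_map]
        simp [sub_eq_add_neg]

end SumOverStableSets

section HookPoly

/-- The polynomial `∏ (1 - (-X) ^ b) / (1 + X)`, with `b` ranging over the cycle lengths `m` of a
permutation. Its `k`-th coefficient is the value of the character of the hook with a leg of
length `k`. -/
def hookPoly (m : Multiset ℕ) : Polynomial ℚ :=
  (m.map fun b => 1 - (-Polynomial.X) ^ b).prod /ₘ (Polynomial.X - Polynomial.C (-1))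

variable {m : Multiset ℕ}

theorem one_add_X_mul_hookPoly (hm : m ≠ 0) :
    (1 + Polynomial.X) * hookPoly m = (m.map fun b => 1 - (-Polynomial.X) ^ b).prod := by
  have hX : (1 + Polynomial.X : Polynomial ℚ) = Polynomial.X - Polynomial.C (-1) := by
    rw [map_neg, map_one, sub_neg_eq_add, add_comm]
  obtain ⟨b, hb⟩ := Multiset.exists_mem_of_ne_zero hm
  rw [hX, hookPoly, Polynomial.mul_divByMonic_eq_iff_isRoot, Polynomial.IsRoot.def,
    Polynomial.eval_multiset_prod, Multiset.map_map, Multiset.prod_eq_zero_iff]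
  exact Multiset.mem_map.2 ⟨b, hb, by simp⟩

theorem one_add_X_ne_zero : (1 + Polynomial.X : Polynomial ℚ) ≠ 0 := by
  rw [add_comm, ← Polynomial.C_1]
  exact Polynomial.X_add_C_ne_zero 1

theorem hookPoly_cons (b : ℕ) (m : Multiset ℕ) : hookPoly (b ::ₘ m) =
    (∑ i ∈ Finset.range b, (-Polynomial.X) ^ i) *
      (m.map fun b => 1 - (-Polynomial.X) ^ b).prod := by
  refine mul_left_cancel₀ one_add_X_ne_zero ?_
  rw [one_add_X_mul_hookPoly Multiset.cons_ne_zero, Multiset.map_cons, Multiset.prod_cons,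
    ← mul_neg_geom_sum (-Polynomial.X) b, sub_neg_eq_add, mul_assoc]

theorem eval_hookPoly_cons (b : ℕ) (m : Multiset ℕ) :
    (hookPoly (b ::ₘ m)).eval (-1) = if m = 0 then (b : ℚ) else 0 := by
  rw [hookPoly_cons]
  split_ifs with hm
  · simp [hm, Polynomial.eval_finsetSum]
  · rw [← one_add_X_mul_hookPoly hm]
    simp

theorem coeff_hookPoly_singleton {b k : ℕ} (hk : k < b) :
    (hookPoly {b}).coeff k = (-1) ^ k := by
  rw [← Multiset.cons_zero, hookPoly_cons, Multiset.map_zero, Multiset.prod_zero, mul_one,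
    Polynomial.finsetSum_coeff, Finset.sum_eq_single_of_mem k (Finset.mem_range.2 hk)]
  · rw [neg_pow, ← Polynomial.C_1, ← Polynomial.C_neg, ← Polynomial.C_pow,
      Polynomial.coeff_C_mul_X_pow, if_pos rfl]
  · intro i _ hik
    rw [neg_pow, ← Polynomial.C_1, ← Polynomial.C_neg, ← Polynomial.C_pow,
      Polynomial.coeff_C_mul_X_pow, if_neg hik.symm]

end HookPoly

section SumOverHooks

open MonoidAlgebra

variable {α : Type*} [Fintype α] [DecidableEq α]

theorem colSum_insert {o : α} {z : Finset α} (ho : o ∉ z) :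
    twistedSum signHom (permsOn (insert o z)) =
      (1 - ∑ x ∈ z, single (swap o x) 1) * twistedSum signHom (permsOn z) := by
  rw [twistedSum_permsOn_insert_eq_sum_mul signHom ho, Finset.sum_insert ho, swap_self,
    sub_eq_add_neg, ← Finset.sum_neg_distrib, MonoidAlgebra.one_def]
  congr 2
  · exact congrArg (single 1) (map_one _)
  · refine Finset.sum_congr rfl fun x hx => ?_
    rw [signHom_swap fun h : o = x => ho (h.symm ▸ hx), single_neg]

theorem rowSum_insert {o : α} {z : Finset α} (ho : o ∉ z) :
    twistedSum (1 : Perm α →* ℚ) (permsOn (insert o z)) =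
      twistedSum 1 (permsOn z) * (1 + ∑ x ∈ z, single (swap o x) 1) := by
  rw [twistedSum_permsOn_insert_eq_mul_sum 1 ho, Finset.sum_insert ho, swap_self,
    MonoidAlgebra.one_def]
  rfl

/-- For the symmetrizer `a` of `zᶜ` and the antisymmetrizer `b` of `z`, enlarging the row or the
column by one point produces the same products `a * swap o x * b`, with opposite signs. -/
theorem sum_hookSymmetrizer_add_sum_hookSymmetrizer_erase (z : Finset α) :
    ∑ o ∈ zᶜ, hookSymmetrizer o z + ∑ o ∈ z, hookSymmetrizer o (z.erase o) =
      Fintype.card α • (twistedSum 1 (permsOn zᶜ) * twistedSum signHom (permsOn z)) := by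
  set a : MonoidAlgebra ℚ (Perm α) := twistedSum 1 (permsOn zᶜ) with ha
  set b : MonoidAlgebra ℚ (Perm α) := twistedSum signHom (permsOn z) with hb
  have hcol : ∑ o ∈ zᶜ, hookSymmetrizer o z =
      zᶜ.card • (a * b) - ∑ o ∈ zᶜ, ∑ x ∈ z, a * single (swap o x) 1 * b := by
    rw [← Finset.sum_const, ← Finset.sum_sub_distrib]
    refine Finset.sum_congr rfl fun o ho => ?_
    rw [hookSymmetrizer, colSum_insert (Finset.mem_compl.1 ho), ← ha, ← hb, sub_mul, one_mul,
      mul_sub, Finset.sum_mul, Finset.mul_sum]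
    simp only [mul_assoc]
  have hrow : ∑ o ∈ z, hookSymmetrizer o (z.erase o) =
      z.card • (a * b) + ∑ o ∈ z, ∑ x ∈ zᶜ, a * single (swap o x) 1 * b := by
    rw [← Finset.sum_const, ← Finset.sum_add_distrib]
    refine Finset.sum_congr rfl fun o ho => ?_
    rw [hookSymmetrizer, Finset.insert_erase ho, Finset.compl_erase,
      rowSum_insert fun h => Finset.mem_compl.1 h ho, ← ha, ← hb, mul_add, mul_one, add_mul,
      Finset.mul_sum, Finset.sum_mul]
  rw [hcol, hrow, Finset.sum_comm (s := z)]
  simp only [swap_comm]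
  rw [sub_add_add_cancel, ← add_smul, add_comm, Finset.card_add_card_compl]

theorem sum_sum_erase {M : Type*} [AddCommMonoid M] (f : α → Finset α → M) :
    ∑ z : Finset α, ∑ o ∈ z, f o (z.erase o) = ∑ z : Finset α, ∑ o ∈ zᶜ, f o z := by
  rw [Finset.sum_sigma', Finset.sum_sigma']
  refine Finset.sum_bij' (fun x _ => ⟨x.1.erase x.2, x.2⟩) (fun x _ => ⟨insert x.2 x.1, x.2⟩)
    ?_ ?_ ?_ ?_ ?_
  all_goals simp +contextual [Finset.insert_erase]

theorem parts_partition_ne_zero [Nonempty α] (σ : Perm α) : σ.partition.parts ≠ 0 := by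
  intro h
  have := σ.partition.parts_sum
  rw [h, Multiset.sum_zero] at this
  exact Fintype.card_ne_zero this.symm

theorem sum_monomial_coeff_hookSymmetrizer [Nonempty α] (σ : Perm α) :
    ∑ z : Finset α, ∑ o ∈ zᶜ, Polynomial.monomial z.card ((hookSymmetrizer o z).coeff σ) =
      Fintype.card α • hookPoly σ.partition.parts := by
  have hshift : Polynomial.X * ∑ z : Finset α, ∑ o ∈ zᶜ,
        Polynomial.monomial z.card ((hookSymmetrizer o z).coeff σ) =
      ∑ z : Finset α, ∑ o ∈ z,
        Polynomial.monomial z.card ((hookSymmetrizer o (z.erase o)).coeff σ) := by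
    simp only [Finset.mul_sum, Polynomial.X_mul_monomial]
    rw [← sum_sum_erase fun o z => Polynomial.monomial (z.card + 1) ((hookSymmetrizer o z).coeff σ)]
    exact Finset.sum_congr rfl fun z _ => Finset.sum_congr rfl fun o ho => by
      rw [Finset.card_erase_add_one ho]
  have hcoeff (z : Finset α) :
      ∑ o ∈ zᶜ, (hookSymmetrizer o z).coeff σ + ∑ o ∈ z, (hookSymmetrizer o (z.erase o)).coeff σ =
        Fintype.card α • (twistedSum 1 (permsOn zᶜ) * twistedSum signHom (permsOn z)).coeff σ := by
    have := congrArg (fun x => x.coeff σ) (sum_hookSymmetrizer_add_sum_hookSymmetrizer_erase z)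
    simpa only [coeff_add, coeff_sum, MonoidAlgebra.coeff_smul, Finsupp.add_apply,
      Finsupp.finsetSum_apply, Finsupp.smul_apply] using this
  refine mul_left_cancel₀ one_add_X_ne_zero ?_
  rw [add_mul, one_mul, hshift, mul_smul_comm, one_add_X_mul_hookPoly (parts_partition_ne_zero σ),
    ← sum_monomial_coeff_rowSum_mul_colSum, ← Finset.sum_add_distrib, Finset.smul_sum]
  refine Finset.sum_congr rfl fun z _ => ?_
  rw [← map_sum, ← map_sum, ← map_add, hcoeff, map_nsmul]

end SumOverHooks

section HookCharacter

theorem card_smul_sum_smul_eq {G β M : Type*} [Group G] [Fintype G] [MulAction G β]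
    [AddCommMonoid M] {S : Finset β} {p : β} (hS : ∀ q, q ∈ S ↔ q ∈ MulAction.orbit G p)
    (f : β → M) : S.card • ∑ g : G, f (g • p) = Fintype.card G • ∑ q ∈ S, f q := by
  classical
  have hmaps (g : G) (_ : g ∈ Finset.univ) : g • p ∈ S := (hS _).2 ⟨g, rfl⟩
  set n := Finset.card {g : G | g • p = p}
  have hfiber {q : β} (hq : q ∈ S) : Finset.card {g : G | g • p = q} = n := by
    obtain ⟨h, rfl⟩ := (hS q).1 hq
    exact (Finset.card_equiv (Equiv.mulLeft h) fun g => by simp [mul_smul]).symm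
  have hcard : Fintype.card G = S.card * n := by
    rw [← Finset.card_univ, Finset.card_eq_sum_card_fiberwise hmaps, Finset.sum_congr rfl
      fun q hq => hfiber hq, Finset.sum_const, smul_eq_mul]
  rw [← Finset.sum_fiberwise_of_maps_to hmaps, hcard, mul_smul, Finset.smul_sum (r := n)]
  congr 1
  refine Finset.sum_congr rfl fun q hq => ?_
  rw [← hfiber hq, ← Finset.sum_const]
  exact Finset.sum_congr rfl fun g hg => by rw [(Finset.mem_filter.1 hg).2]

open MonoidAlgebra
open scoped Pointwise

variable {α : Type*} [Fintype α] [DecidableEq α] {o : α} {z : Finset α}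

/-- The pairs of a corner and a leg of length `k`. -/
def hookFillings (α : Type*) [Fintype α] [DecidableEq α] (k : ℕ) : Finset (Finset α × α) :=
  {x | x.1.card = k ∧ x.2 ∉ x.1}

theorem sum_hookFillings {M : Type*} [AddCommMonoid M] (k : ℕ) (f : Finset α × α → M) :
    ∑ x ∈ hookFillings α k, f x = ∑ z : Finset α, if z.card = k then ∑ o ∈ zᶜ, f (z, o) else 0 := by
  rw [hookFillings, Finset.sum_filter, Fintype.sum_prod_type]
  refine Finset.sum_congr rfl fun z _ => ?_
  split_ifs with hz
  · simp only [hz, true_and, ← Finset.mem_compl, Finset.sum_ite_mem, Finset.univ_inter]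
  · simp only [hz, false_and, if_false, Finset.sum_const_zero]

theorem card_hookFillings_mul (ho : o ∉ z) : (hookFillings α z.card).card *
    (z.card.factorial * (zᶜ.erase o).card.factorial) = (Fintype.card α).factorial := by
  have hcard : (hookFillings α z.card).card = (Fintype.card α).choose z.card * zᶜ.card := by
    rw [Finset.card_eq_sum_ones, sum_hookFillings, ← Finset.sum_filter,
      Finset.univ_filter_card_eq, ← Finset.card_univ, ← Finset.card_powersetCard]
    refine Finset.sum_const_nat fun w hw => ?_
    rw [← Finset.card_eq_sum_ones, Finset.card_compl, Finset.card_compl,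
      (Finset.mem_powersetCard.1 hw).2]
  have hcompl : zᶜ.card = (zᶜ.erase o).card + 1 :=
    (Finset.card_erase_add_one (Finset.mem_compl.2 ho)).symm
  have hchoose := Nat.choose_mul_factorial_mul_factorial (Finset.card_le_univ z)
  rw [← Finset.card_compl, hcompl, Nat.factorial_succ, ← hcompl] at hchoose
  rw [hcard, ← hchoose]
  ring

theorem mem_hookFillings_iff_mem_orbit (ho : o ∉ z) (q : Finset α × α) :
    q ∈ hookFillings α z.card ↔ q ∈ MulAction.orbit (Perm α) (z, o) := by
  simp only [hookFillings, Finset.mem_filter_univ, MulAction.mem_orbit_iff]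
  constructor
  · rintro ⟨hcard, hq⟩
    have := Set.powersetCard.isPretransitive (α := α) (n := z.card)
    obtain ⟨τ, hτ⟩ := MulAction.exists_smul_eq (Perm α)
      (⟨z, rfl⟩ : Set.powersetCard α z.card) (⟨q.1, hcard⟩ : Set.powersetCard α z.card)
    have hτz : τ • z = q.1 := congrArg Subtype.val hτ
    have hτo : τ o ∉ q.1 := by rwa [← hτz, ← Perm.smul_def, Finset.smul_mem_smul_finset_iff]
    refine ⟨swap (τ o) q.2 * τ, Prod.ext ?_ (swap_apply_left _ _)⟩
    rw [mul_smul, Prod.smul_fst, Prod.smul_fst, hτz]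
    have hswap : swap (τ o) q.2 ∈ permsOn q.1ᶜ :=
      swap_mem_permsOn (Finset.mem_compl.2 hτo) (Finset.mem_compl.2 hq)
    refine Finset.ext fun x => ?_
    rw [← Finset.inv_smul_mem_iff, swap_inv, Perm.smul_def, ← not_iff_not, ← Finset.mem_compl,
      ← Finset.mem_compl, apply_mem_of_mem_permsOn hswap]
  · rintro ⟨τ, rfl⟩
    exact ⟨Finset.card_smul_finset τ z, mt (Finset.smul_mem_smul_finset_iff τ).1 ho⟩

theorem trace_span_hookSymmetrizer (ho : o ∉ z) (σ : Perm α) :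
    LinearMap.trace ℚ (Submodule.span (MonoidAlgebra ℚ (Perm α)) {hookSymmetrizer o z})
      (Algebra.lsmul ℚ ℚ _ (of ℚ (Perm α) σ)) = (hookPoly σ.partition.parts).coeff z.card := by
  have : Nonempty α := ⟨o⟩
  have hparts : σ⁻¹.partition.parts = σ.partition.parts := by
    rw [Perm.parts_partition, Perm.parts_partition, Perm.cycleType_inv, Perm.support_inv]
  have hsum : ∑ x ∈ hookFillings α z.card, (hookSymmetrizer x.2 x.1).coeff σ⁻¹ =
      Fintype.card α * (hookPoly σ.partition.parts).coeff z.card := by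
    have := congrArg (fun p => p.coeff z.card) (sum_monomial_coeff_hookSymmetrizer σ⁻¹)
    rw [Polynomial.coeff_smul, hparts, nsmul_eq_mul] at this
    rw [← this, sum_hookFillings, Polynomial.finsetSum_coeff]
    refine Finset.sum_congr rfl fun w _ => ?_
    split_ifs with hw <;> simp [Polynomial.coeff_monomial, hw]
  have havg := card_smul_sum_smul_eq (mem_hookFillings_iff_mem_orbit ho)
    fun x => (hookSymmetrizer x.2 x.1).coeff σ⁻¹
  have hfillings : (hookFillings α z.card).card ≠ 0 :=
    Finset.card_ne_zero_of_mem
      ((mem_hookFillings_iff_mem_orbit ho _).2 (MulAction.mem_orbit_self _))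
  have hn : ((Fintype.card α * (z.card.factorial * (zᶜ.erase o).card.factorial) : ℕ) : ℚ) ≠ 0 := by
    positivity
  rw [hsum, Fintype.card_perm, ← card_hookFillings_mul ho, mul_smul] at havg
  rw [trace_lsmul_span_singleton hn (hookSymmetrizer_mul_self ho), coeff_sum,
    Finsupp.finsetSum_apply, div_eq_iff hn]
  simp only [conj_hookSymmetrizer]
  refine (smul_right_injective ℚ hfillings havg).trans ?_
  rw [nsmul_eq_mul]
  push_cast
  ring

end HookCharacter

/-! ### Young symmetrizers of hook shape -/

section FiberStabilizer

variable {α : Type*}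

/-- The permutations preserving the fibres of a function. For the row and column functions of a
tableau these are its row group and its column group. -/
def fiberStabilizer {β : Type*} (f : α → β) : Subgroup (Perm α) where
  carrier := {σ | ∀ x, f (σ x) = f x}
  mul_mem' hσ hτ x := (hσ _).trans (hτ x)
  one_mem' _ := rfl
  inv_mem' {σ} hσ x := by simpa using (hσ (σ⁻¹ x)).symm

theorem mem_fiberStabilizer {β : Type*} {f : α → β} {σ : Perm α} :
    σ ∈ fiberStabilizer f ↔ ∀ x, f (σ x) = f x :=
  Iff.rfl

theorem swap_mem_fiberStabilizer [DecidableEq α] {β : Type*} {f : α → β} {x y : α}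
    (h : f x = f y) : swap x y ∈ fiberStabilizer f := by
  intro z
  rw [swap_apply_def]
  split_ifs with hx hy
  · rw [hx, h]
  · rw [hy, h]
  · rfl

theorem fiberStabilizer_eq_permsOn {f g : α → ℕ} {s : Finset α}
    (hs : ∀ x, x ∈ s ↔ f x = 0) (hfg : ∀ x, f x = 0 ∨ g x = 0)
    (hinj : ∀ x y, f x = f y → g x = g y → x = y) : fiberStabilizer f = permsOn s := by
  ext σ
  refine ⟨fun hσ => mem_permsOn.2 fun x hx => ?_, fun hσ x => ?_⟩
  · rw [hs] at hx
    have hfx : f (σ x) = f x := hσ x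
    have hgx : g x = 0 := (hfg x).resolve_left hx
    have hgx' : g (σ x) = 0 := (hfg (σ x)).resolve_left (hfx.trans_ne hx)
    exact hinj _ _ hfx (hgx'.trans hgx.symm)
  · by_cases hx : x ∈ s
    · rw [(hs _).1 ((apply_mem_of_mem_permsOn hσ).2 hx), (hs _).1 hx]
    · rw [mem_permsOn.1 hσ x hx]

end FiberStabilizer

section Tableau

variable {d : ℕ} {lam : d.Partition} (t : Tableau lam)

theorem Tableau.ext_row_col {x y : Fin d} (hrow : Tableau.row t x = Tableau.row t y)
    (hcol : Tableau.col t x = Tableau.col t y) : x = y :=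
  t.injective (Subtype.ext (Prod.ext hrow hcol))

theorem Tableau.exists_row_col {c : ℕ × ℕ} (hc : c ∈ (youngDiagram lam).cells) :
    ∃ x, Tableau.row t x = c.1 ∧ Tableau.col t x = c.2 :=
  ⟨t.symm ⟨c, hc⟩, by simp [Tableau.row], by simp [Tableau.col]⟩

theorem rowSymmetrizer_eq_twistedSum :
    rowSymmetrizer t = twistedSum 1 (fiberStabilizer (Tableau.row t)) := by
  classical
  simp only [rowSymmetrizer, twistedSum, mem_fiberStabilizer, MonoidHom.one_apply]

theorem colAntisymmetrizer_eq_twistedSum :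
    colAntisymmetrizer t = twistedSum signHom (fiberStabilizer (Tableau.col t)) := by
  classical
  simp only [colAntisymmetrizer, twistedSum, mem_fiberStabilizer]
  rfl

end Tableau

/-- The hook partition `(d - k, 1, …, 1)` of `d` with `k` rows below the first one. -/
def hookPartition {d : ℕ} (k : Fin d) : d.Partition where
  parts := (d - k) ::ₘ Multiset.replicate k 1
  parts_pos := by
    intro i hi
    rcases Multiset.mem_cons.1 hi with rfl | hi
    · exact Nat.sub_pos_of_lt k.2
    · exact (Multiset.eq_of_mem_replicate hi).symm ▸ one_pos
  parts_sum := by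
    rw [Multiset.sum_cons, Multiset.sum_replicate, smul_eq_mul, mul_one,
      Nat.sub_add_cancel k.2.le]

theorem sortedParts_hookPartition {d : ℕ} (k : Fin d) :
    sortedParts (hookPartition k) = (d - k) :: List.replicate k 1 := by
  have hsorted : ((d - k : ℕ) :: List.replicate k 1).SortedGE := by
    refine (List.pairwise_cons.2 ⟨fun a ha => ?_, ?_⟩).sortedGE
    · exact (List.eq_of_mem_replicate ha).trans_le (Nat.sub_pos_of_lt k.2)
    · exact List.pairwise_replicate.2 (Or.inr le_rfl)
  refine List.Perm.eq_of_sortedGE (sortedParts_sortedGE _) hsorted ?_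
  rw [← Multiset.coe_eq_coe, sortedParts, Multiset.sort_eq, hookPartition, ← Multiset.cons_coe,
    Multiset.coe_replicate]

theorem hookPartition_injective {d : ℕ} : Function.Injective (hookPartition (d := d)) := by
  intro k l h
  have hcard := congrArg (fun p : d.Partition => p.parts.card) h
  simp only [hookPartition, Multiset.card_cons, Multiset.card_replicate] at hcard
  exact Fin.ext (Nat.succ_injective hcard)

theorem mem_youngDiagram_hookPartition {d : ℕ} (k : Fin d) {c : ℕ × ℕ} :
    c ∈ (youngDiagram (hookPartition k)).cells ↔
      (c.1 = 0 ∧ c.2 < d - k) ∨ (0 < c.1 ∧ c.1 ≤ k ∧ c.2 = 0) := by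
  rw [YoungDiagram.mem_cells, youngDiagram, YoungDiagram.mem_ofRowLens]
  simp only [sortedParts_hookPartition]
  obtain ⟨_ | i, j⟩ := c
  · simp
  · simp only [List.length_cons, List.length_replicate, List.getElem_cons_succ,
      List.getElem_replicate, exists_prop]
    omega

section HookTableau

variable {d : ℕ} {k : Fin d} (t : Tableau (hookPartition k))

theorem row_eq_zero_or_col_eq_zero (x : Fin d) : Tableau.row t x = 0 ∨ Tableau.col t x = 0 :=
  ((mem_youngDiagram_hookPartition k).1 (t x).2).imp And.left fun h => h.2.2

theorem card_filter_row_ne_zero : ({x | Tableau.row t x ≠ 0} : Finset (Fin d)).card = k := by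
  rw [← Nat.add_sub_cancel (k : ℕ) 1, ← Nat.card_Icc]
  have hcol {x} (hx : x ∈ ({x | Tableau.row t x ≠ 0} : Finset _)) : Tableau.col t x = 0 :=
    (row_eq_zero_or_col_eq_zero t x).resolve_left ((Finset.mem_filter_univ x).1 hx)
  refine Finset.card_bij (fun x _ => Tableau.row t x) (fun x hx => ?_)
    (fun x hx y hy hxy => Tableau.ext_row_col t hxy ((hcol hx).trans (hcol hy).symm)) fun i hi => ?_
  · have hcell := (mem_youngDiagram_hookPartition k).1 (t x).2
    rw [Finset.mem_filter_univ, Tableau.row] at hx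
    rw [Tableau.row, Finset.mem_Icc]
    omega
  · rw [Finset.mem_Icc] at hi
    obtain ⟨x, hx, -⟩ := Tableau.exists_row_col t
      ((mem_youngDiagram_hookPartition k (c := (i, 0))).2 (Or.inr ⟨hi.1, hi.2, rfl⟩))
    exact ⟨x, (Finset.mem_filter_univ x).2 (hx.trans_ne (Nat.ne_of_gt hi.1)), hx⟩

theorem exists_youngSymmetrizer_eq_hookSymmetrizer :
    ∃ o, ∃ z : Finset (Fin d), o ∉ z ∧ z.card = k ∧ youngSymmetrizer t = hookSymmetrizer o z := by
  have hcorner : ((0, 0) : ℕ × ℕ) ∈ (youngDiagram (hookPartition k)).cells :=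
    (mem_youngDiagram_hookPartition k).2 (Or.inl ⟨rfl, Nat.sub_pos_of_lt k.2⟩)
  obtain ⟨o, hrow, hcol⟩ := Tableau.exists_row_col t hcorner
  refine ⟨o, ({x | Tableau.row t x ≠ 0} : Finset _), by simpa using hrow,
    card_filter_row_ne_zero t, ?_⟩
  have hor := row_eq_zero_or_col_eq_zero t
  have hR : fiberStabilizer (Tableau.row t) = permsOn ({x | Tableau.row t x ≠ 0} : Finset _)ᶜ :=
    fiberStabilizer_eq_permsOn (by simp) hor fun _ _ => Tableau.ext_row_col t
  have hC : fiberStabilizer (Tableau.col t) =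
      permsOn (insert o ({x | Tableau.row t x ≠ 0} : Finset _)) := by
    refine fiberStabilizer_eq_permsOn (fun x => ?_) (fun x => (hor x).symm)
      fun _ _ h h' => Tableau.ext_row_col t h' h
    rw [Finset.mem_insert, Finset.mem_filter_univ]
    constructor
    · rintro (rfl | hx)
      exacts [hcol, (hor x).resolve_left hx]
    · intro hx
      by_contra! h
      exact h.1 (Tableau.ext_row_col t (h.2.trans hrow.symm) (hx.trans hcol.symm))
  rw [youngSymmetrizer, rowSymmetrizer_eq_twistedSum, colAntisymmetrizer_eq_twistedSum, hR, hC,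
    hookSymmetrizer]

end HookTableau

theorem parts_partition_permOfPartition {d : ℕ} (mu : d.Partition) :
    (permOfPartition mu).partition.parts = mu.parts :=
  (exists_perm_of_partition mu).choose_spec

theorem chi_hookPartition {d : ℕ} (k : Fin d) (mu : d.Partition) :
    chi (hookPartition k) mu = (hookPoly mu.parts).coeff k := by
  have hchar (t : Tableau (hookPartition k)) (σ : Perm (Fin d)) :
      (spechtRep t).character σ = (hookPoly σ.partition.parts).coeff k := by
    obtain ⟨o, z, ho, hz, ht⟩ := exists_youngSymmetrizer_eq_hookSymmetrizer t
    rw [← hz, ← trace_span_hookSymmetrizer ho σ, ← ht]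
    rfl
  rw [chi, irrChar, hchar, parts_partition_permOfPartition]

/-! ### Vanishing of the non-hook characters on long cycles -/

theorem eq_hookPartition_or_exists_box {d : ℕ} (hd : 0 < d) (lam : d.Partition) :
    (∃ k : Fin d, lam = hookPartition k) ∨
      ∃ a l : ℕ, a + l ≤ d ∧ ∀ c ∈ (youngDiagram lam).cells, c.1 < l ∧ c.2 < a := by
  have hparts : (sortedParts lam : Multiset ℕ) = lam.parts := Multiset.sort_eq _ _
  have hsum : (sortedParts lam).sum = d := by rw [← Multiset.sum_coe, hparts, lam.parts_sum]
  have hpos : ∀ b ∈ sortedParts lam, 1 ≤ b := fun b hb =>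
    lam.parts_pos (hparts ▸ Multiset.mem_coe.2 hb)
  have hcells {c} (hc : c ∈ (youngDiagram lam).cells) :
      ∃ h : c.1 < (sortedParts lam).length, c.2 < (sortedParts lam)[c.1] :=
    YoungDiagram.mem_ofRowLens.1 ((YoungDiagram.mem_cells _).1 hc)
  have hsorted := sortedParts_sortedGE lam
  generalize sortedParts lam = w at *
  obtain _ | ⟨a, w⟩ := w
  · exact absurd hsum hd.ne
  rw [List.forall_mem_cons] at hpos
  rw [List.sum_cons] at hsum
  by_cases hw : ∀ b ∈ w, b = 1
  · have hlength : w.sum = w.length := by simpa using List.sum_eq_card_nsmul w 1 hw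
    refine Or.inl ⟨⟨w.length, by omega⟩, Nat.Partition.ext ?_⟩
    simp only [hookPartition]
    rw [← hparts, ← Multiset.cons_coe, ← Multiset.coe_replicate, ← List.eq_replicate_of_mem hw,
      ← hsum, hlength, Nat.add_sub_cancel]
  · obtain ⟨b, hb, hb1⟩ : ∃ b ∈ w, b ≠ 1 := by push Not at hw; exact hw
    have hlength : w.length < w.sum := by
      simpa using List.sum_lt_sum (fun _ => 1) id hpos.2 ⟨b, hb, (hpos.2 b hb).lt_of_ne' hb1⟩
    refine Or.inr ⟨a, w.length + 1, by omega, fun c hc => ?_⟩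
    obtain ⟨hrow, hcol⟩ := hcells hc
    exact ⟨hrow, hcol.trans_le
      (hsorted.getElem_ge_getElem_of_le (hj := Nat.succ_pos _) (Nat.zero_le c.1))⟩

section LongCycles

variable {α : Type*} [Fintype α] [DecidableEq α]

theorem twistedSum_permsOn_mul_mul_twistedSum_fiberStabilizer_eq_zero {R : Type*} [CommRing R]
    [NoZeroDivisors R] {ε ε' : Perm α →* R} (hε : ∀ x y, x ≠ y → ε (swap x y) ≠ ε' (swap x y))
    {s : Finset α} {f : α → ℕ} {n : ℕ} (hf : ∀ x, f x < n) (hs : n < s.card)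
    (y : MonoidAlgebra R (Perm α)) :
    twistedSum ε (permsOn s) * y * twistedSum ε' (fiberStabilizer f) = 0 := by
  refine mul_mul_eq_zero_of_single (fun σ r => ?_) y
  obtain ⟨x, hx, y, hy, hxy, hfxy⟩ := Finset.exists_ne_map_eq_of_card_lt_of_maps_to
    (s := s) (t := Finset.range n) (f := fun x => f (σ⁻¹ x)) (by rwa [Finset.card_range])
    fun x _ => Finset.mem_coe.2 (Finset.mem_range.2 (hf _))
  refine twistedSum_mul_single_mul_twistedSum_eq_zero_of_swap (x := σ⁻¹ x) (y := σ⁻¹ y) r ?_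
    (swap_mem_fiberStabilizer hfxy) (hε _ _ (σ⁻¹.injective.ne hxy))
  simpa using swap_mem_permsOn hx hy

theorem card_smul_sum_single_eval_hookPoly [Nonempty α] :
    (Fintype.card α : ℚ) •
        ∑ σ : Perm α, MonoidAlgebra.single σ ((hookPoly σ.partition.parts).eval (-1)) =
      ∑ z : Finset α, ∑ o ∈ zᶜ, ((-1) ^ z.card : ℚ) • hookSymmetrizer o z := by
  ext σ
  have h := congrArg (Polynomial.eval (-1)) (sum_monomial_coeff_hookSymmetrizer σ)
  simp only [Polynomial.eval_finsetSum, Polynomial.eval_monomial, Polynomial.eval_smul] at h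
  simp only [MonoidAlgebra.coeff_smul, MonoidAlgebra.coeff_sum, Finsupp.smul_apply,
    Finsupp.finsetSum_apply, MonoidAlgebra.coeff_single, Finsupp.single_apply, smul_eq_mul,
    Finset.sum_ite_eq', Finset.mem_univ, if_true]
  simp only [nsmul_eq_mul] at h
  rw [← h]
  exact Finset.sum_congr rfl fun z _ => Finset.sum_congr rfl fun o _ => mul_comm _ _

theorem eval_hookPoly_parts_partition [Nonempty α] (σ : Perm α) :
    (hookPoly σ.partition.parts).eval (-1) =
      if σ.partition.parts = {Fintype.card α} then (Fintype.card α : ℚ) else 0 := by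
  have hsum := σ.partition.parts_sum
  obtain ⟨b, hb⟩ := Multiset.exists_mem_of_ne_zero (parts_partition_ne_zero σ)
  obtain ⟨m, hm⟩ := Multiset.exists_cons_of_mem hb
  rw [hm, Multiset.sum_cons] at hsum
  rw [hm, eval_hookPoly_cons]
  by_cases h : m = 0
  · obtain rfl : b = Fintype.card α := by simpa [h] using hsum
    simp [h]
  · rw [if_neg h, if_neg]
    exact fun h' => h (by simpa using congrArg Multiset.card h')

theorem sum_longCycles_mul_eq_zero [Nonempty α] {v : MonoidAlgebra ℚ (Perm α)}
    (hv : ∀ o z, o ∉ z → hookSymmetrizer o z * v = 0) :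
    (∑ σ : Perm α with σ.partition.parts = {Fintype.card α}, MonoidAlgebra.single σ (1 : ℚ)) * v =
      0 := by
  have hcard : (Fintype.card α : ℚ) ≠ 0 := Nat.cast_ne_zero.2 Fintype.card_ne_zero
  have h : (∑ z : Finset α, ∑ o ∈ zᶜ, ((-1) ^ z.card : ℚ) • hookSymmetrizer o z) * v = 0 := by
    simp_rw [Finset.sum_mul, smul_mul_assoc]
    refine Finset.sum_eq_zero fun z _ => Finset.sum_eq_zero fun o ho => ?_
    rw [hv o z (Finset.mem_compl.1 ho), smul_zero]
  have hsum : ∑ σ : Perm α, MonoidAlgebra.single σ ((hookPoly σ.partition.parts).eval (-1)) =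
      (Fintype.card α : ℚ) •
        ∑ σ : Perm α with σ.partition.parts = {Fintype.card α}, MonoidAlgebra.single σ (1 : ℚ) := by
    rw [Finset.smul_sum, Finset.sum_filter]
    refine Finset.sum_congr rfl fun σ _ => ?_
    rw [eval_hookPoly_parts_partition]
    split_ifs
    · rw [MonoidAlgebra.smul_single, smul_eq_mul, mul_one]
    · exact MonoidAlgebra.single_zero σ
  rw [← card_smul_sum_single_eval_hookPoly, hsum, smul_smul, smul_mul_assoc] at h
  exact (smul_eq_zero.1 h).resolve_left (mul_ne_zero hcard hcard)

end LongCycles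

section Box

variable {d : ℕ} {lam : d.Partition} {a l : ℕ}

theorem hookSymmetrizer_mul_mul_youngSymmetrizer_eq_zero (hal : a + l ≤ d)
    (hbox : ∀ c ∈ (youngDiagram lam).cells, c.1 < l ∧ c.2 < a) (t : Tableau lam)
    {o : Fin d} {z : Finset (Fin d)} (ho : o ∉ z) (y : GroupAlg d) :
    hookSymmetrizer o z * (y * youngSymmetrizer t) = 0 := by
  have hassoc : hookSymmetrizer o z * (y * youngSymmetrizer t) =
      twistedSum 1 (permsOn zᶜ) * (twistedSum signHom (permsOn (insert o z)) * y *
        twistedSum 1 (fiberStabilizer (Tableau.row t))) *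
          twistedSum signHom (fiberStabilizer (Tableau.col t)) := by
    simp only [hookSymmetrizer, youngSymmetrizer, rowSymmetrizer_eq_twistedSum,
      colAntisymmetrizer_eq_twistedSum, mul_assoc]
  have hcard : a < zᶜ.card ∨ l < (insert o z).card := by
    have := z.card_le_univ
    rw [Finset.card_compl, Finset.card_insert_of_notMem ho]
    rw [Fintype.card_fin] at *
    omega
  rw [hassoc]
  obtain hcol | hrow := hcard
  · exact twistedSum_permsOn_mul_mul_twistedSum_fiberStabilizer_eq_zero
      (fun _ _ => one_swap_ne_signHom_swap) (fun x => (hbox _ (t x).2).2) hcol _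
  · rw [twistedSum_permsOn_mul_mul_twistedSum_fiberStabilizer_eq_zero (f := Tableau.row t)
      (fun _ _ h => (one_swap_ne_signHom_swap h).symm) (fun x => (hbox _ (t x).2).1) hrow,
      mul_zero, zero_mul]

theorem character_spechtRep_eq_of_parts_eq (t : Tableau lam) {σ τ : Perm (Fin d)}
    (h : σ.partition.parts = τ.partition.parts) :
    (spechtRep t).character σ = (spechtRep t).character τ := by
  obtain ⟨g, hg⟩ := isConj_iff.1 (Perm.partition_eq_of_isConj.2 (Nat.Partition.ext h))
  rw [← hg, Representation.char_conj]

theorem character_spechtRep_eq_zero_of_box (hd : 0 < d) (hal : a + l ≤ d)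
    (hbox : ∀ c ∈ (youngDiagram lam).cells, c.1 < l ∧ c.2 < a) (t : Tableau lam)
    {σ : Perm (Fin d)} (hσ : σ.partition.parts = {d}) : (spechtRep t).character σ = 0 := by
  have : Nonempty (Fin d) := ⟨⟨0, hd⟩⟩
  set longCycles : Finset (Perm (Fin d)) := {τ | τ.partition.parts = {d}}
  have hzero : Algebra.lsmul ℚ ℚ (SpechtModule t)
      (∑ τ ∈ longCycles, MonoidAlgebra.of ℚ (Perm (Fin d)) τ) = 0 := by
    ext1 ⟨x, hx⟩
    obtain ⟨y, rfl⟩ := Submodule.mem_span_singleton.1 hx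
    refine Subtype.ext (?_ : (∑ τ ∈ longCycles, MonoidAlgebra.single τ (1 : ℚ)) *
      (y * youngSymmetrizer t) = 0)
    simpa only [Fintype.card_fin] using sum_longCycles_mul_eq_zero fun o z ho =>
      hookSymmetrizer_mul_mul_youngSymmetrizer_eq_zero hal hbox t ho y
  have htrace : ∑ τ ∈ longCycles, (spechtRep t).character τ = 0 := by
    have := congrArg (LinearMap.trace ℚ (SpechtModule t)) hzero
    rwa [map_sum, map_sum, map_zero] at this
  rw [Finset.sum_congr rfl fun τ hτ => character_spechtRep_eq_of_parts_eq t
    (((Finset.mem_filter_univ τ).1 hτ).trans hσ.symm), Finset.sum_const] at htrace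
  refine (smul_eq_zero.1 htrace).resolve_left (Finset.card_ne_zero.2 ⟨σ, ?_⟩)
  exact (Finset.mem_filter_univ σ).2 hσ

end Box

theorem chi_hookPartition_indiscrete {d : ℕ} (k : Fin d) :
    chi (hookPartition k) (Nat.Partition.indiscrete d) = (-1) ^ (k : ℕ) := by
  rw [chi_hookPartition, Nat.Partition.indiscrete_parts (Fin.pos k).ne',
    coeff_hookPoly_singleton k.2]

theorem chi_indiscrete_eq_zero {d : ℕ} (hd : 0 < d) {lam : d.Partition}
    (hlam : ∀ k, lam ≠ hookPartition k) : chi lam (Nat.Partition.indiscrete d) = 0 := by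
  obtain ⟨k, hk⟩ | ⟨a, l, hal, hbox⟩ := eq_hookPartition_or_exists_box hd lam
  · exact absurd hk (hlam k)
  · refine character_spechtRep_eq_zero_of_box hd hal hbox _ ?_
    rw [parts_partition_permOfPartition, Nat.Partition.indiscrete_parts hd.ne']

theorem sum_chi_indiscrete_mul {d : ℕ} (hd : 0 < d) (f : d.Partition → ℚ) :
    ∑ lam : d.Partition, chi lam (Nat.Partition.indiscrete d) * f lam =
      ∑ k : Fin d, (-1) ^ (k : ℕ) * f (hookPartition k) := by
  symm
  refine Finset.sum_of_injOn hookPartition hookPartition_injective.injOn (by simp)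
    (fun lam _ hlam => ?_) fun k _ => ?_
  · rw [chi_indiscrete_eq_zero hd, zero_mul]
    exact fun k hk => hlam ⟨k, by simp [hk]⟩
  · rw [chi_hookPartition_indiscrete]

section CompletedCycles

variable {d : ℕ}

theorem shiftedPowerSum_hookPartition (n : ℕ) (k : Fin d) :
    shiftedPowerSum n (hookPartition k) = (d - k - 1 / 2 : ℚ) ^ n - (-k - 1 / 2 : ℚ) ^ n := by
  have hleg : ∑ i : Fin (List.replicate (k : ℕ) 1).length,
      ((((List.replicate (k : ℕ) 1).get i : ℕ) - ((i + 1 : ℕ) : ℚ) - 1 / 2) ^ n -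
        (-((i + 1 : ℕ) : ℚ) - 1 / 2) ^ n) = (-((0 : ℕ) : ℚ) - 1 / 2) ^ n - (-k - 1 / 2) ^ n := by
    rw [← Finset.sum_range_sub' fun i : ℕ => (-(i : ℚ) - 1 / 2) ^ n,
      ← Finset.sum_congr (congrArg Finset.range List.length_replicate) fun _ _ => rfl,
      Finset.sum_range]
    refine Finset.sum_congr rfl fun i _ => ?_
    rw [List.get_eq_getElem, List.getElem_replicate]
    push_cast
    ring
  rw [shiftedPowerSum, sortedParts_hookPartition]
  refine (Fin.sum_univ_succ _).trans ?_
  refine (congrArg _ hleg).trans ?_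
  simp [Nat.cast_sub k.2.le]

theorem shiftedPowerSum_three_hookPartition (k : Fin d) :
    shiftedPowerSum 3 (hookPartition k) / 6 =
      d / 2 * (((k : ℚ) - (d - 1) / 2) ^ 2 + d ^ 2 / 12) := by
  rw [shiftedPowerSum_hookPartition]
  ring

theorem numCycles_two_indiscrete (hd : 0 < d) {g s : ℕ} {β : d.Partition}
    (hs : (2 * s : ℤ) = 2 * g - 1 + len β) :
    numCycles g 2 (Nat.Partition.indiscrete d) β = s := by
  rw [numCycles, len, Nat.Partition.indiscrete_parts hd.ne', Multiset.card_singleton]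
  omega

theorem doubleHurwitz_indiscrete_eq_sum_coeff_hookPoly (hd : 0 < d) {g s : ℕ} {β : d.Partition}
    (hs : (2 * s : ℤ) = 2 * g - 1 + len β) :
    doubleHurwitz g 2 (Nat.Partition.indiscrete d) β =
      (d : ℚ) ^ ((s : ℤ) - 1) / (2 ^ s * β.parts.prod) * ∑ k ∈ Finset.range d,
        (-1) ^ k * (((k : ℚ) - (d - 1) / 2) ^ 2 + d ^ 2 / 12) ^ s * (hookPoly β.parts).coeff k := by
  have hd' : (d : ℚ) ≠ 0 := by exact_mod_cast hd.ne'
  have hsix : (((2 + 1).factorial : ℕ) : ℚ) = 6 := by norm_num [Nat.factorial]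
  rw [doubleHurwitz, numCycles_two_indiscrete hd hs, Nat.Partition.indiscrete_parts hd.ne',
    Multiset.prod_singleton]
  simp_rw [mul_assoc (chi _ _)]
  rw [sum_chi_indiscrete_mul hd, Finset.sum_range, Finset.mul_sum, Finset.mul_sum]
  refine Finset.sum_congr rfl fun k _ => ?_
  rw [hsix, shiftedPowerSum_three_hookPartition, chi_hookPartition, mul_pow, div_pow,
    zpow_sub_one₀ hd', zpow_natCast]
  ring

end CompletedCycles

/-! ### The hook characters at `q = -exp z` -/

section SinhProduct

theorem coeff_sinhSeries (n : ℕ) :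
    coeff n sinhSeries = 1 / 2 * (1 - (-1) ^ n) / (n.factorial : ℚ) := by
  rw [sinhSeries, coeff_C_mul, map_sub, coeff_rescale, coeff_exp, Algebra.algebraMap_self,
    RingHom.id_apply]
  ring

theorem constantCoeff_sinhc : constantCoeff sinhc = 1 := by
  rw [← coeff_zero_eq_constantCoeff_apply, sinhc, coeff_mk, coeff_sinhSeries]
  norm_num

/-- The power series `sinh (iz/2) / (iz/2)`. -/
def sinhcHalf (i : ℕ) : ℚ⟦X⟧ := rescale ((i : ℚ) / 2) sinhc

theorem constantCoeff_sinhcHalf (i : ℕ) : constantCoeff (sinhcHalf i) = 1 := by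
  rw [sinhcHalf, ← coeff_zero_eq_constantCoeff_apply, coeff_rescale, pow_zero, one_mul,
    coeff_zero_eq_constantCoeff_apply, constantCoeff_sinhc]

theorem constantCoeff_sinhcHalf_ne_zero (i : ℕ) : constantCoeff (sinhcHalf i) ≠ 0 := by
  rw [constantCoeff_sinhcHalf]
  exact one_ne_zero

theorem sinhcHalf_ne_zero (i : ℕ) : sinhcHalf i ≠ 0 :=
  fun h => constantCoeff_sinhcHalf_ne_zero i (by rw [h, map_zero])

theorem C_mul_X_mul_sinhcHalf (i : ℕ) : C (i : ℚ) * X * sinhcHalf i =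
    rescale ((i : ℚ) / 2) (exp ℚ) - rescale (-((i : ℚ) / 2)) (exp ℚ) := by
  ext n
  rw [mul_assoc, coeff_C_mul]
  rcases n with _ | n
  · rw [coeff_zero_X_mul, mul_zero, map_sub, coeff_rescale, coeff_rescale, pow_zero, pow_zero,
      sub_self]
  · rw [coeff_succ_X_mul, sinhcHalf, coeff_rescale, sinhc, coeff_mk, coeff_sinhSeries, map_sub,
      coeff_rescale, coeff_rescale, neg_pow ((i : ℚ) / 2), coeff_exp, Algebra.algebraMap_self,
      RingHom.id_apply, pow_succ ((i : ℚ) / 2)]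
    ring

theorem rescale_exp_mul_one_sub_exp_pow (b : ℕ) :
    rescale (-((b : ℚ) / 2)) (exp ℚ) * (1 - exp ℚ ^ b) = -X * C (b : ℚ) * sinhcHalf b := by
  rw [exp_pow_eq_rescale_exp, mul_sub, mul_one, exp_mul_exp_eq_exp_add,
    show -((b : ℚ) / 2) + b = b / 2 by ring]
  linear_combination C_mul_X_mul_sinhcHalf b

theorem rescale_exp_mul_prod_one_sub_exp_pow (m : Multiset ℕ) :
    rescale (-((m.sum : ℚ) / 2)) (exp ℚ) * (m.map fun b => 1 - exp ℚ ^ b).prod =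
      (-X) ^ m.card * C (m.prod : ℚ) * (m.map sinhcHalf).prod := by
  induction m using Multiset.induction_on with
  | empty =>
    ext n
    simp [coeff_one]
  | cons b m ih =>
    have hsplit : -(((b + m.sum : ℕ) : ℚ) / 2) = -((b : ℚ) / 2) + -((m.sum : ℚ) / 2) := by
      push_cast
      ring
    rw [Multiset.sum_cons, Multiset.map_cons, Multiset.prod_cons, hsplit,
      ← exp_mul_exp_eq_exp_add, mul_mul_mul_comm, ih, rescale_exp_mul_one_sub_exp_pow,
      Multiset.card_cons, Multiset.prod_cons, Multiset.map_cons, Multiset.prod_cons,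
      Nat.cast_mul, map_mul, pow_succ]
    ring

/-- The power series `∏ (sinh (iz/2) / (iz/2)) / (sinh (z/2) / (z/2))`, with `i` ranging over a
multiset. For the parts of `β` it is the power series expansion of `sinhProduct β`. -/
def sinhProductSeries (m : Multiset ℕ) : ℚ⟦X⟧ :=
  (m.map sinhcHalf).prod * (sinhcHalf 1)⁻¹

theorem sinhcHalf_one_mul_sinhProductSeries (m : Multiset ℕ) :
    sinhcHalf 1 * sinhProductSeries m = (m.map sinhcHalf).prod := by
  rw [sinhProductSeries, mul_left_comm,
    PowerSeries.mul_inv_cancel _ (constantCoeff_sinhcHalf_ne_zero 1), mul_one]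

theorem constantCoeff_sinhProductSeries (m : Multiset ℕ) :
    constantCoeff (sinhProductSeries m) = 1 := by
  rw [sinhProductSeries, map_mul, PowerSeries.constantCoeff_inv, constantCoeff_sinhcHalf, inv_one,
    mul_one, map_multiset_prod, Multiset.map_map]
  exact Multiset.prod_eq_one fun x hx => by
    obtain ⟨i, _, rfl⟩ := Multiset.mem_map.1 hx
    exact constantCoeff_sinhcHalf i

variable {m : Multiset ℕ}

theorem one_sub_exp_mul_aeval_hookPoly (hm : m ≠ 0) :
    (1 - exp ℚ) * Polynomial.aeval (-exp ℚ) (hookPoly m) =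
      (m.map fun b => 1 - exp ℚ ^ b).prod := by
  have h := congrArg (Polynomial.aeval (-exp ℚ)) (one_add_X_mul_hookPoly hm)
  rw [map_mul, map_add, map_one, Polynomial.aeval_X, ← sub_eq_add_neg, map_multiset_prod,
    Multiset.map_map] at h
  rw [h]
  exact congrArg _ (Multiset.map_congr rfl fun b _ => by simp)

theorem rescale_exp_mul_aeval_hookPoly (hm : m ≠ 0) :
    rescale (-(((m.sum : ℚ) - 1) / 2)) (exp ℚ) * Polynomial.aeval (-exp ℚ) (hookPoly m) =
      (-X) ^ (m.card - 1) * C (m.prod : ℚ) * sinhProductSeries m := by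
  have hsplit : -((m.sum : ℚ) / 2) = -(((1 : ℕ) : ℚ) / 2) + -(((m.sum : ℚ) - 1) / 2) := by
    push_cast
    ring
  have hcard : (-X : ℚ⟦X⟧) ^ m.card = -X * (-X) ^ (m.card - 1) := by
    rw [← pow_succ', Nat.sub_add_cancel (Multiset.card_pos.2 hm)]
  have hone := rescale_exp_mul_one_sub_exp_pow 1
  rw [pow_one, Nat.cast_one, map_one, mul_one] at hone
  have hprod := rescale_exp_mul_prod_one_sub_exp_pow m
  rw [hsplit, ← exp_mul_exp_eq_exp_add, ← one_sub_exp_mul_aeval_hookPoly hm, mul_mul_mul_comm,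
    Nat.cast_one, hone, hcard, ← sinhcHalf_one_mul_sinhProductSeries] at hprod
  refine mul_left_cancel₀ (mul_ne_zero (neg_ne_zero.2 X_ne_zero) (sinhcHalf_ne_zero 1)) ?_
  rw [hprod]
  ring

theorem natDegree_hookPoly_le (m : Multiset ℕ) : (hookPoly m).natDegree ≤ m.sum - 1 := by
  rw [hookPoly, Polynomial.natDegree_divByMonic _ (Polynomial.monic_X_sub_C _),
    Polynomial.natDegree_X_sub_C]
  refine Nat.sub_le_sub_right ((Polynomial.natDegree_multiset_prod_le _).trans ?_) 1
  rw [Multiset.map_map]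
  refine (Multiset.sum_map_le_sum_map _ id fun b _ => ?_).trans_eq (by rw [Multiset.map_id])
  rw [Function.comp_apply, id, neg_pow]
  compute_degree

theorem aeval_neg_exp_hookPoly (hm : 0 < m.sum) : Polynomial.aeval (-exp ℚ) (hookPoly m) =
    ∑ k ∈ Finset.range m.sum, C ((-1) ^ k * (hookPoly m).coeff k) * rescale (k : ℚ) (exp ℚ) := by
  have hdeg : (hookPoly m).natDegree < m.sum := (natDegree_hookPoly_le m).trans_lt (by omega)
  rw [Polynomial.aeval_eq_sum_range' hdeg]
  refine Finset.sum_congr rfl fun k _ => ?_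
  rw [← exp_pow_eq_rescale_exp, neg_pow, map_mul, map_pow, map_neg, map_one, smul_eq_C_mul]
  ring

theorem sum_pow_mul_coeff_hookPoly (hm : 0 < m.sum) (n : ℕ) :
    ∑ k ∈ Finset.range m.sum,
        (-1) ^ k * ((k : ℚ) - (m.sum - 1) / 2) ^ n * (hookPoly m).coeff k =
      n.factorial * m.prod * coeff n ((-X) ^ (m.card - 1) * sinhProductSeries m) := by
  have hm0 : m ≠ 0 := fun h => by simp [h] at hm
  have h := congrArg (coeff n) (rescale_exp_mul_aeval_hookPoly hm0)
  rw [mul_right_comm, mul_comm _ (C _), coeff_C_mul, aeval_neg_exp_hookPoly hm, Finset.mul_sum,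
    map_sum] at h
  rw [mul_assoc, ← h, Finset.mul_sum]
  refine Finset.sum_congr rfl fun k _ => ?_
  rw [mul_left_comm (rescale _ _), exp_mul_exp_eq_exp_add, coeff_C_mul, coeff_rescale, coeff_exp,
    Algebra.algebraMap_self, RingHom.id_apply]
  field_simp
  ring

end SinhProduct

section PartsMultiplicity

theorem prod_map_eq_prod_pow_count {ι M : Type*} [DecidableEq ι] [CommMonoid M] {m : Multiset ι}
    {s : Finset ι} (hs : m.toFinset ⊆ s) (f : ι → M) :
    (m.map f).prod = ∏ i ∈ s, f i ^ m.count i := by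
  rw [Finset.prod_multiset_map_count]
  refine Finset.prod_subset hs fun i _ hi => ?_
  rw [Multiset.count_eq_zero.2 (mt Multiset.mem_toFinset.2 hi), pow_zero]

theorem sum_map_eq_sum_count_mul {ι R : Type*} [DecidableEq ι] [CommSemiring R] {m : Multiset ι}
    {s : Finset ι} (hs : m.toFinset ⊆ s) (f : ι → R) :
    (m.map f).sum = ∑ i ∈ s, m.count i * f i := by
  rw [Finset.sum_multiset_map_count]
  simp_rw [nsmul_eq_mul]
  refine Finset.sum_subset hs fun i _ hi => ?_
  rw [Multiset.count_eq_zero.2 (mt Multiset.mem_toFinset.2 hi), Nat.cast_zero, zero_mul]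

variable {d : ℕ} (β : d.Partition)

theorem toFinset_parts_subset_Icc : β.parts.toFinset ⊆ Finset.Icc 1 d := fun _ hi =>
  Finset.mem_Icc.2 ⟨β.parts_pos (Multiset.mem_toFinset.1 hi),
    β.le_of_mem_parts (Multiset.mem_toFinset.1 hi)⟩

theorem coe_inv_sinhcHalf (i : ℕ) : (((sinhcHalf i)⁻¹ : ℚ⟦X⟧) : LaurentSeries ℚ) =
    ((sinhcHalf i : ℚ⟦X⟧) : LaurentSeries ℚ)⁻¹ := by
  refine eq_inv_of_mul_eq_one_left ?_
  rw [← map_mul, PowerSeries.inv_mul_cancel _ (constantCoeff_sinhcHalf_ne_zero i), map_one]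

theorem coe_sinhcHalf_zpow_cExp (i : ℕ) :
    ((sinhcHalf i : ℚ⟦X⟧) : LaurentSeries ℚ) ^ cExp β i =
      ((sinhcHalf i : ℚ⟦X⟧) : LaurentSeries ℚ) ^ β.parts.count i *
        if i = 1 then ((sinhcHalf 1 : ℚ⟦X⟧) : LaurentSeries ℚ)⁻¹ else 1 := by
  have hne : ((sinhcHalf i : ℚ⟦X⟧) : LaurentSeries ℚ) ≠ 0 :=
    (map_ne_zero_iff _ HahnSeries.ofPowerSeries_injective).2 (sinhcHalf_ne_zero i)
  rw [cExp, zpow_sub₀ hne, zpow_natCast, div_eq_mul_inv]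
  split_ifs with hi
  · rw [zpow_one, hi]
  · rw [zpow_zero, inv_one]

theorem sinhProduct_eq_coe (hd : 0 < d) :
    sinhProduct β = ((sinhProductSeries β.parts : ℚ⟦X⟧) : LaurentSeries ℚ) := by
  refine (Finset.prod_congr rfl fun i _ => coe_sinhcHalf_zpow_cExp β i).trans ?_
  rw [Finset.prod_mul_distrib, Finset.prod_ite_eq', if_pos (Finset.mem_Icc.2 ⟨le_rfl, hd⟩),
    sinhProductSeries, map_mul, coe_inv_sinhcHalf, map_multiset_prod, Multiset.map_map,
    prod_map_eq_prod_pow_count (toFinset_parts_subset_Icc β)]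
  rfl

theorem powS_eq_sum_map_sub_one (hd : 0 < d) (j : ℕ) :
    powS β j = (β.parts.map fun i : ℕ => (i : ℚ) ^ j).sum - 1 := by
  have hone : ∑ k ∈ Finset.Icc 1 d, (if k = 1 then (k : ℚ) ^ j else 0) = 1 := by
    rw [Finset.sum_ite_eq', if_pos (Finset.mem_Icc.2 ⟨le_rfl, hd⟩), Nat.cast_one, one_pow]
  rw [sum_map_eq_sum_count_mul (toFinset_parts_subset_Icc β), ← hone, ← Finset.sum_sub_distrib,
    powS]
  refine Finset.sum_congr rfl fun k _ => ?_
  rw [cExp]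
  split_ifs <;> push_cast <;> ring

end PartsMultiplicity

/-! ### The exponential formula -/

section HasLog

open Finset.HasAntidiagonal

/-- `F' = F G'`, that is, `G` is a formal logarithm of `F` up to a constant. -/
def HasLog {R : Type*} [CommRing R] (F G : R⟦X⟧) : Prop :=
  PowerSeries.derivative R F = F * PowerSeries.derivative R G

section CommRing

variable {R : Type*} [CommRing R] {F F₁ F₂ G G₁ G₂ : R⟦X⟧}

theorem hasLog_one : HasLog (1 : R⟦X⟧) 0 := by
  rw [HasLog, map_zero, mul_zero]
  exact PowerSeries.derivative_one

theorem HasLog.mul (h₁ : HasLog F₁ G₁) (h₂ : HasLog F₂ G₂) : HasLog (F₁ * F₂) (G₁ + G₂) := by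
  rw [HasLog] at *
  rw [Derivation.leibniz, h₁, h₂, map_add, smul_eq_mul, smul_eq_mul]
  ring

theorem HasLog.multiset_prod {ι : Type*} (m : Multiset ι) {F G : ι → R⟦X⟧}
    (h : ∀ i, HasLog (F i) (G i)) : HasLog (m.map F).prod (m.map G).sum := by
  induction m using Multiset.induction_on with
  | empty => simpa using hasLog_one
  | cons a m ih =>
    rw [Multiset.map_cons, Multiset.map_cons, Multiset.prod_cons, Multiset.sum_cons]
    exact (h a).mul ih

theorem derivative_rescale (a : R) (F : R⟦X⟧) :
    PowerSeries.derivative R (rescale a F) = C a * rescale a (PowerSeries.derivative R F) := by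
  ext n
  rw [PowerSeries.coeff_derivative, coeff_rescale, coeff_C_mul, coeff_rescale,
    PowerSeries.coeff_derivative]
  ring

theorem HasLog.rescale (h : HasLog F G) (a : R) :
    HasLog (PowerSeries.rescale a F) (PowerSeries.rescale a G) := by
  rw [HasLog] at *
  rw [derivative_rescale, derivative_rescale, h, map_mul, mul_left_comm]

theorem coeff_X_mul_derivative (F : R⟦X⟧) (n : ℕ) :
    coeff n (X * PowerSeries.derivative R F) = n * coeff n F := by
  rcases n with _ | n
  · simp
  · rw [coeff_succ_X_mul, PowerSeries.coeff_derivative, mul_comm, Nat.cast_succ]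

theorem HasLog.natCast_mul_coeff (h : HasLog F G) (n : ℕ) :
    n * coeff n F =
      ∑ p ∈ antidiagonal n, coeff p.1 F * (p.2 * coeff p.2 G) := by
  simp only [← coeff_X_mul_derivative]
  rw [h, mul_left_comm, PowerSeries.coeff_mul]

theorem hasLog_logOf [Algebra ℚ R] (hF : constantCoeff F = 1) : HasLog F (logOf F) := by
  have hsubst : HasSubst (F - 1) := HasSubst.of_constantCoeff_zero' (by simp [hF])
  have hlog : PowerSeries.derivative R (PowerSeries.log R) * (1 + X) = 1 := by
    rw [PowerSeries.deriv_log]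
    ext n
    rw [mul_add, mul_one, map_add]
    rcases n with _ | n
    · simp
    · simp [coeff_succ_mul_X, coeff_one, pow_succ]
  have hlogF := congrArg (PowerSeries.subst (F - 1)) hlog
  rw [← coe_substAlgHom hsubst, map_mul, map_add, map_one, coe_substAlgHom, subst_X hsubst,
    add_sub_cancel] at hlogF
  rw [HasLog, logOf_eq, PowerSeries.derivative_subst hsubst, map_sub, PowerSeries.derivative_one,
    sub_zero]
  linear_combination -(PowerSeries.derivative R F) * hlogF

end CommRing

section Field

variable {K : Type*} [Field K] {F G : K⟦X⟧}

theorem HasLog.inv (h : HasLog F G) (hF : constantCoeff F ≠ 0) : HasLog F⁻¹ (-G) := by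
  rw [HasLog] at *
  rw [PowerSeries.derivative_inv', h, map_neg]
  linear_combination -(F⁻¹ * PowerSeries.derivative K G) * PowerSeries.inv_mul_cancel F hF

theorem HasLog.coeff_eq_zero_of_odd [CharZero K] (h : HasLog F G) (hF : F ≠ 0)
    (heven : PowerSeries.rescale (-1) F = F) {n : ℕ} (hn : Odd n) : coeff n G = 0 := by
  have hG : PowerSeries.rescale (-1) G = G := by
    have hneg := h.rescale (-1)
    rw [heven] at hneg
    refine PowerSeries.derivative.ext (mul_left_cancel₀ hF (hneg.symm.trans h)) ?_
    rw [← coeff_zero_eq_constantCoeff_apply, coeff_rescale, pow_zero, one_mul,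
      coeff_zero_eq_constantCoeff_apply]
  have hcoeff := congrArg (coeff n) hG
  rwa [coeff_rescale, hn.neg_one_pow, neg_one_mul, CharZero.neg_eq_self_iff] at hcoeff

end Field

end HasLog

section PartitionSum

open Finset.HasAntidiagonal

variable {K : Type*} [Field K] (a : ℕ → K)

/-- `∏ a_p / ∏ m_i!`, where `p` runs over a multiset in which `i` has multiplicity `m_i`. -/
def multisetWeight (m : Multiset ℕ) : K :=
  (m.map a).prod / ((∏ i ∈ m.toFinset, (m.count i).factorial : ℕ) : K)

/-- The sum of the weights `∏ a_{λ_i} / |Aut λ|` of all partitions `λ` of `n`: by the exponential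
formula, the coefficient of `x ^ n` in `exp (∑ a_i x ^ i)`. -/
def partitionSum (n : ℕ) : K :=
  ∑ lam : n.Partition, multisetWeight a lam.parts

theorem partitionSum_zero : partitionSum a 0 = 1 := by
  rw [partitionSum, Fintype.sum_unique, Nat.Partition.partition_zero_parts, multisetWeight]
  simp

theorem prod_factorial_count_cons {ι : Type*} [DecidableEq ι] (j : ι) (m : Multiset ι) :
    ∏ i ∈ (j ::ₘ m).toFinset, ((j ::ₘ m).count i).factorial =
      (m.count j + 1) * ∏ i ∈ m.toFinset, (m.count i).factorial := by
  have hsub : m.toFinset ⊆ (j ::ₘ m).toFinset :=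
    Multiset.toFinset_subset.2 (Multiset.subset_cons m j)
  have hj : j ∈ (j ::ₘ m).toFinset := Multiset.mem_toFinset.2 (Multiset.mem_cons_self j m)
  rw [Finset.prod_subset hsub fun i _ hi => by
      rw [Multiset.count_eq_zero.2 (mt Multiset.mem_toFinset.2 hi), Nat.factorial_zero],
    ← Finset.mul_prod_erase _ _ hj, ← Finset.mul_prod_erase _ _ hj, ← mul_assoc,
    Multiset.count_cons_self, Nat.factorial_succ]
  congr 1
  refine Finset.prod_congr rfl fun i hi => ?_
  rw [Multiset.count_cons_of_ne (Finset.ne_of_mem_erase hi)]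

variable [CharZero K]

theorem count_mul_multisetWeight_cons (j : ℕ) (m : Multiset ℕ) :
    ((j ::ₘ m).count j : K) * multisetWeight a (j ::ₘ m) = a j * multisetWeight a m := by
  have hfact : ((∏ i ∈ m.toFinset, (m.count i).factorial : ℕ) : K) ≠ 0 :=
    Nat.cast_ne_zero.2 (Finset.prod_ne_zero_iff.2 fun i _ => Nat.factorial_ne_zero _)
  have hcount : ((m.count j + 1 : ℕ) : K) ≠ 0 := Nat.cast_ne_zero.2 (Nat.succ_ne_zero _)
  rw [multisetWeight, multisetWeight, prod_factorial_count_cons, Multiset.map_cons,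
    Multiset.prod_cons, Multiset.count_cons_self, Nat.cast_mul]
  field_simp

theorem sum_count_mul_multisetWeight {n j : ℕ} (hj : 1 ≤ j) (hjn : j ≤ n) :
    ∑ lam : n.Partition, (lam.parts.count j : K) * multisetWeight a lam.parts =
      a j * partitionSum a (n - j) := by
  classical
  rw [← Fintype.sum_subtype_add_sum_subtype fun lam : n.Partition => j ∈ lam.parts,
    Finset.sum_eq_zero (s := (Finset.univ : Finset {lam : n.Partition // j ∉ lam.parts}))
      fun lam _ => by rw [Multiset.count_eq_zero.2 lam.2, Nat.cast_zero, zero_mul],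
    add_zero, partitionSum, Finset.mul_sum]
  refine Fintype.sum_equiv (Nat.Partition.partitionWithPartEquiv hj hjn) _ _ fun lam => ?_
  rw [Nat.Partition.partitionWithPartEquiv_apply_parts, ← count_mul_multisetWeight_cons,
    Multiset.cons_erase lam.2]

theorem natCast_mul_partitionSum (n : ℕ) :
    n * partitionSum a n =
      ∑ p ∈ antidiagonal n, partitionSum a p.1 * (p.2 * a p.2) := by
  have hsize (lam : n.Partition) :
      (n : K) = ∑ j ∈ Finset.Icc 1 n, (lam.parts.count j : K) * j := by
    rw [← sum_map_eq_sum_count_mul (toFinset_parts_subset_Icc lam), ← Nat.cast_multiset_sum,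
      lam.parts_sum]
  calc n * partitionSum a n
      = ∑ j ∈ Finset.Icc 1 n, j * ∑ lam : n.Partition,
          (lam.parts.count j : K) * multisetWeight a lam.parts := by
        simp_rw [partitionSum, Finset.mul_sum]
        rw [Finset.sum_comm]
        refine Finset.sum_congr rfl fun lam _ => ?_
        rw [hsize lam, Finset.sum_mul]
        exact Finset.sum_congr rfl fun j _ => by ring
    _ = ∑ j ∈ Finset.Icc 1 n, partitionSum a (n - j) * (j * a j) := by
        refine Finset.sum_congr rfl fun j hj => ?_
        obtain ⟨hj, hjn⟩ := Finset.mem_Icc.1 hj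
        rw [sum_count_mul_multisetWeight a hj hjn]
        ring
    _ = ∑ j ∈ Finset.range (n + 1), partitionSum a (n - j) * (j * a j) := by
        refine Finset.sum_subset (fun j hj => ?_) fun j hj hj' => ?_
        · exact Finset.mem_range_succ_iff.2 (Finset.mem_Icc.1 hj).2
        · obtain rfl : j = 0 := by
            rw [Finset.mem_range] at hj
            rw [Finset.mem_Icc] at hj'
            omega
          rw [Nat.cast_zero, zero_mul, mul_zero]
    _ = ∑ p ∈ antidiagonal n, partitionSum a p.1 * (p.2 * a p.2) := by
        rw [← Finset.Nat.sum_antidiagonal_swap,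
          Finset.Nat.sum_antidiagonal_eq_sum_range_succ_mk]
        rfl

theorem eq_partitionSum_of_recurrence {q : ℕ → K} (hzero : q 0 = 1)
    (hrec : ∀ n : ℕ, n * q n = ∑ p ∈ antidiagonal n, q p.1 * (p.2 * a p.2))
    (n : ℕ) : q n = partitionSum a n := by
  induction n using Nat.strong_induction_on with
  | _ n ih =>
    obtain rfl | hn := Nat.eq_zero_or_pos n
    · rw [hzero, partitionSum_zero]
    · refine mul_left_cancel₀ (Nat.cast_ne_zero.2 hn.ne') ?_
      rw [hrec, natCast_mul_partitionSum]
      refine Finset.sum_congr rfl fun p hp => ?_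
      rw [mem_antidiagonal] at hp
      obtain hp2 | hp2 := Nat.eq_zero_or_pos p.2
      · rw [hp2, Nat.cast_zero, zero_mul, mul_zero, mul_zero]
      · rw [ih p.1 (by omega)]

theorem sum_antidiagonal_two_mul {M : Type*} [AddCommMonoid M] (n : ℕ) {f : ℕ × ℕ → M}
    (hf : ∀ p, Odd p.2 → f p = 0) :
    ∑ p ∈ antidiagonal (2 * n), f p =
      ∑ p ∈ antidiagonal n, f (2 * p.1, 2 * p.2) := by
  symm
  refine Finset.sum_of_injOn (fun p => (2 * p.1, 2 * p.2)) ?_ ?_ ?_ fun _ _ => rfl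
  · intro p _ q _ h
    simp only [Prod.mk.injEq] at h
    exact Prod.ext (by omega) (by omega)
  · intro p hp
    simp only [Finset.mem_coe, mem_antidiagonal] at hp ⊢
    omega
  · intro p hp hp'
    refine hf p (Nat.not_even_iff_odd.1 fun ⟨j, hj⟩ => hp' ⟨(n - j, j), ?_⟩)
    rw [mem_antidiagonal] at hp
    simp only [Finset.mem_coe, mem_antidiagonal, Prod.ext_iff]
    omega

theorem HasLog.coeff_two_mul_eq_partitionSum {F G : K⟦X⟧} (h : HasLog F G)
    (hF : constantCoeff F = 1) (hG : ∀ j, Odd j → coeff j G = 0) (n : ℕ) :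
    coeff (2 * n) F = partitionSum (fun j => coeff (2 * j) G) n := by
  refine eq_partitionSum_of_recurrence _ (q := fun n => coeff (2 * n) F) ?_ (fun k => ?_) n
  · rw [mul_zero, coeff_zero_eq_constantCoeff_apply, hF]
  · have hrec := h.natCast_mul_coeff (2 * k)
    rw [sum_antidiagonal_two_mul k fun p hp => by rw [hG _ hp, mul_zero, mul_zero]] at hrec
    refine mul_left_cancel₀ (two_ne_zero (α := K)) ?_
    rw [Finset.mul_sum, ← mul_assoc]
    push_cast at hrec
    rw [hrec]
    exact Finset.sum_congr rfl fun p _ => by ring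

end PartitionSum

/-! ### The explicit formulae -/

section ExplicitFormulae

theorem rescale_neg_one_sinhc : rescale (-1 : ℚ) sinhc = sinhc := by
  ext n
  rw [coeff_rescale, sinhc, coeff_mk, coeff_sinhSeries]
  obtain hn | hn := Nat.even_or_odd n
  · rw [hn.neg_one_pow, one_mul]
  · rw [hn.add_one.neg_one_pow, sub_self, mul_zero, zero_div, mul_zero]

theorem xi_eq_zero_of_odd {n : ℕ} (hn : Odd n) : xi n = 0 := by
  have hne : sinhc ≠ 0 := fun h => by simpa [h] using constantCoeff_sinhc
  exact (hasLog_logOf constantCoeff_sinhc).coeff_eq_zero_of_odd hne rescale_neg_one_sinhc hn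

/-- The formal logarithm of `sinhProductSeries m`. -/
def sinhProductLog (m : Multiset ℕ) : ℚ⟦X⟧ :=
  (m.map fun i : ℕ => rescale ((i : ℚ) / 2) (logOf sinhc)).sum +
    -rescale (((1 : ℕ) : ℚ) / 2) (logOf sinhc)

theorem hasLog_sinhProductSeries (m : Multiset ℕ) :
    HasLog (sinhProductSeries m) (sinhProductLog m) := by
  have h (i : ℕ) : HasLog (sinhcHalf i) (rescale ((i : ℚ) / 2) (logOf sinhc)) :=
    (hasLog_logOf constantCoeff_sinhc).rescale _
  exact (HasLog.multiset_prod m h).mul ((h 1).inv (constantCoeff_sinhcHalf_ne_zero 1))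

theorem coeff_sinhProductLog (m : Multiset ℕ) (n : ℕ) :
    coeff n (sinhProductLog m) = xi n * ((m.map fun i : ℕ => (i : ℚ) ^ n).sum - 1) / 2 ^ n := by
  have hfactor (i : ℕ) : coeff n (rescale ((i : ℚ) / 2) (logOf sinhc)) =
      i ^ n * (xi n / 2 ^ n) := by
    rw [coeff_rescale, xi, div_pow]
    ring
  rw [sinhProductLog, map_add, map_neg, map_multiset_sum, Multiset.map_map, hfactor]
  simp only [Function.comp_def, hfactor, Multiset.sum_map_mul_right, Nat.cast_one, one_pow]
  ring

variable {d : ℕ}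

theorem multisetWeight_coeff_sinhProductLog (hd : 0 < d) (β : d.Partition) {n : ℕ}
    (lam : n.Partition) :
    multisetWeight (fun j => coeff (2 * j) (sinhProductLog β.parts)) lam.parts =
      xiTwo lam * powSTwo β lam / autCard lam / 2 ^ (2 * n) := by
  have hpow (p : Multiset ℕ) : (p.map fun j => (2 : ℚ) ^ (2 * j)).prod = 2 ^ (2 * p.sum) := by
    induction p using Multiset.induction with
    | empty => simp
    | cons j p ih => simp [ih, mul_add, pow_add]
  simp only [multisetWeight, coeff_sinhProductLog, ← powS_eq_sum_map_sub_one β hd,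
    Multiset.prod_map_div, Multiset.prod_map_mul, hpow, lam.parts_sum]
  rw [xiTwo, powSTwo, autCard, div_right_comm]

theorem coeff_sinhProductSeries_two_mul (hd : 0 < d) (β : d.Partition) (n : ℕ) :
    coeff (2 * n) (sinhProductSeries β.parts) =
      (∑ lam : n.Partition, xiTwo lam * powSTwo β lam / autCard lam) / 2 ^ (2 * n) := by
  rw [(hasLog_sinhProductSeries _).coeff_two_mul_eq_partitionSum
    (constantCoeff_sinhProductSeries _) fun j hj => by
      rw [coeff_sinhProductLog, xi_eq_zero_of_odd hj, zero_mul, zero_div],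
    partitionSum, Finset.sum_div]
  exact Finset.sum_congr rfl fun lam _ => multisetWeight_coeff_sinhProductLog hd β lam

theorem coeff_sinhProduct_eq_sum_partition (hd : 0 < d) (β : d.Partition) {g h : ℕ} (hh : h ≤ g) :
    (sinhProduct β).coeff (2 * ((g : ℤ) - h)) =
      (∑ lam : (g - h).Partition, xiTwo lam * powSTwo β lam / autCard lam) / 2 ^ (2 * (g - h)) := by
  rw [← coeff_sinhProductSeries_two_mul hd, sinhProduct_eq_coe β hd, ← Nat.cast_sub hh,
    ← Nat.cast_ofNat, ← Nat.cast_mul, LaurentSeries.coeff_coe_powerSeries]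

theorem sum_add_pow_mul_coeff_hookPoly {m : Multiset ℕ} (hm : 0 < m.sum) (a : ℚ) (s : ℕ) :
    ∑ k ∈ Finset.range m.sum,
        (-1) ^ k * (((k : ℚ) - (m.sum - 1) / 2) ^ 2 + a) ^ s * (hookPoly m).coeff k =
      ∑ h ∈ Finset.range (s + 1), a ^ h * s.choose h * ((2 * s - 2 * h).factorial * m.prod *
        coeff (2 * s - 2 * h) ((-X) ^ (m.card - 1) * sinhProductSeries m)) := by
  simp_rw [← sum_pow_mul_coeff_hookPoly hm, Finset.mul_sum]
  rw [Finset.sum_comm]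
  refine Finset.sum_congr rfl fun k _ => ?_
  rw [add_comm _ a, add_pow, Finset.mul_sum, Finset.sum_mul]
  refine Finset.sum_congr rfl fun h _ => ?_
  rw [← pow_mul, Nat.mul_sub]
  ring

theorem coeff_X_pow_mul_sinhProductSeries (hd : 0 < d) {β : d.Partition} {g s h : ℕ}
    (hs : (2 * s : ℤ) = 2 * g - 1 + len β) (hh : h ≤ s) :
    coeff (2 * s - 2 * h) ((-X) ^ (β.parts.card - 1) * sinhProductSeries β.parts) =
      if h ≤ g then (sinhProduct β).coeff (2 * ((g : ℤ) - h)) else 0 := by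
  rw [len] at hs
  have heven : Even (β.parts.card - 1) := by
    rw [Nat.even_iff]
    omega
  rw [heven.neg_pow, coeff_X_pow_mul']
  split_ifs with hX hg hg
  · rw [sinhProduct_eq_coe β hd, show 2 * ((g : ℤ) - h) = ((2 * (g - h) : ℕ) : ℤ) by omega,
      LaurentSeries.coeff_coe_powerSeries]
    congr 2
    omega
  all_goals first | rfl | omega

theorem doubleHurwitz_indiscrete_eq_sum_coeff_sinhProduct (hd : 0 < d) {g s : ℕ} {β : d.Partition}
    (hs : (2 * s : ℤ) = 2 * g - 1 + len β) :
    doubleHurwitz g 2 (Nat.Partition.indiscrete d) β =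
      (s.factorial : ℚ) * (d : ℚ) ^ ((s : ℤ) - 1) / 2 ^ s *
        ∑ h ∈ Finset.range (g + 1), ((2 * s - 2 * h).factorial : ℚ) /
          ((h.factorial : ℚ) * ((s - h).factorial : ℚ) * 12 ^ h) * (d : ℚ) ^ (2 * h) *
          (sinhProduct β).coeff (2 * ((g : ℤ) - (h : ℤ))) := by
  have hprod : (β.parts.prod : ℚ) ≠ 0 :=
    Nat.cast_ne_zero.2 (Multiset.prod_ne_zero fun h => (β.parts_pos h).ne rfl)
  have hgs : g ≤ s := by omega
  have hsum := sum_add_pow_mul_coeff_hookPoly (m := β.parts) (by rwa [β.parts_sum])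
    ((d : ℚ) ^ 2 / 12) s
  rw [β.parts_sum] at hsum
  rw [doubleHurwitz_indiscrete_eq_sum_coeff_hookPoly hd hs, hsum,
    ← Finset.sum_subset (Finset.range_mono (Nat.succ_le_succ hgs)), Finset.mul_sum, Finset.mul_sum]
  · refine Finset.sum_congr rfl fun h hh => ?_
    have hhg : h ≤ g := Finset.mem_range_succ_iff.1 hh
    rw [coeff_X_pow_mul_sinhProductSeries hd hs (hhg.trans hgs), if_pos hhg,
      Nat.cast_choose ℚ (hhg.trans hgs), div_pow, ← pow_mul]
    field_simp
  · intro h hh hh'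
    rw [coeff_X_pow_mul_sinhProductSeries hd hs (Finset.mem_range_succ_iff.1 hh),
      if_neg (mt Finset.mem_range_succ_iff.2 hh'), mul_zero, mul_zero]

end ExplicitFormulae

end Hurwitz

end

theorem theorem1p2 (g d : ℕ) (hd : 0 < d) (β : d.Partition) (hβ : Odd (Hurwitz.len β))
    (s : ℕ) (hs : (2 * s : ℤ) = 2 * g - 1 + Hurwitz.len β) :
    Hurwitz.doubleHurwitz g 2 (Nat.Partition.indiscrete d) β =
        (s.factorial : ℚ) * (d : ℚ) ^ ((s : ℤ) - 1) / 2 ^ s *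
          ∑ h ∈ Finset.range (g + 1),
            ((2 * s - 2 * h).factorial : ℚ) /
              ((h.factorial : ℚ) * ((s - h).factorial : ℚ) * 12 ^ h) * (d : ℚ) ^ (2 * h) *
              (Hurwitz.sinhProduct β).coeff (2 * ((g : ℤ) - (h : ℤ))) ∧
      Hurwitz.doubleHurwitz g 2 (Nat.Partition.indiscrete d) β =
        (s.factorial : ℚ) * (d : ℚ) ^ ((s : ℤ) - 1) / 2 ^ (s + 2 * g) *
          ∑ h ∈ Finset.range (g + 1),
            ((2 * s - 2 * h).factorial : ℚ) /
              ((h.factorial : ℚ) * ((s - h).factorial : ℚ) * 3 ^ h) * (d : ℚ) ^ (2 * h) *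
              ∑ lam : (g - h).Partition,
                Hurwitz.xiTwo lam * Hurwitz.powSTwo β lam / (Hurwitz.autCard lam : ℚ) := by
  refine ⟨Hurwitz.doubleHurwitz_indiscrete_eq_sum_coeff_sinhProduct hd hs, ?_⟩
  rw [Hurwitz.doubleHurwitz_indiscrete_eq_sum_coeff_sinhProduct hd hs, Finset.mul_sum,
    Finset.mul_sum]
  refine Finset.sum_congr rfl fun h hh => ?_
  have hhg : h ≤ g := Finset.mem_range_succ_iff.1 hh
  have htwelve : (12 : ℚ) ^ h = 3 ^ h * 2 ^ (2 * h) := by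
    rw [pow_mul, ← mul_pow]
    norm_num
  have htwo : (2 : ℚ) ^ (2 * g) = 2 ^ (2 * h) * 2 ^ (2 * (g - h)) := by
    rw [← pow_add, ← mul_add, Nat.add_sub_cancel' hhg]
  rw [Hurwitz.coeff_sinhProduct_eq_sum_partition hd β hhg, pow_add, htwelve, htwo]
  field_simp
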